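/- \textbf{Setting.} Let $H$ be a complex Hilbert space, $\Delta$ a strictly positive (possibly unbounded) operator on $H$, i.e. $\Delta$ is self-adjoint and $\langle x,\Delta x\rangle\ge c\|x\|^2$ on its domain for some $c>0$, and let $r\ge 2$ be an integer (the order of $\Delta$). Put $H^\infty=\bigcap_{n}\mathrm{dom}(\Delta^n)$. The complex powers $\Delta^z$ ($z\in\mathbb C$) are regarded as linear operators on $H^\infty$. For $s\in\mathbb R$ let $H^s$ be the completion of $H^\infty$ in the norm $\|v\|_s=\|\Delta^{s/r}v\|$. For $t\in\mathbb R$, $\mathrm{Op}^t$ is the set of linear operators $T:H^\infty\to H^\infty$ that extend to bounded operators $H^s\to H^{s-t}$ for every $s\in\mathbb R$. Let $\mathcal D=\bigcup_{m\in\mathbb N}\mathcal D^m$ be an $\mathbb N$-filtered algebra of linear operators on $H^\infty$, equipped with a linear (not necessarily multiplicative) automorphism $\theta$ preserving the filtration, such that (i) $\nabla(X):=\Delta X-\theta^r(X)\Delta$ maps $\mathcal D^m$ into $\mathcal D^{m+r-1}$ for every $m$; (ii) for every $X\in\mathcal D^m$ there is $C>0$ with $\|Xv\|\le C\|\Delta^{m/r}v\|$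 for all $v\in H^\infty$. Assume that $\theta$ is diagonalizable with positive spectrum, i.e. $\mathcal D$ is the algebraic direct sum of the eigenspaces of $\theta$ and all eigenvalues are strictly positive reals; $\theta^w$ ($w\in\mathbb C$) acts on the $\lambda$-eigenspace as $\lambda^w$. Let $W\subset(0,\infty)$ be the set of eigenvalues of $\theta^r$ (the weights), $X^\mu$ the component of $X\in\mathcal D$ in the $\mu$-eigenspace of $\theta^r$, and $W(k)=W^{k+1}$. For $\boldsymbol\mu=(\mu_0,\dots,\mu_k)\in W(k)$ define $\nabla^{\boldsymbol\mu}(X)=X^{\mu_0}$ if $k=0$ and $\nabla^{\boldsymbol\mu}(X)=\big(\nabla(\nabla^{(\mu_0,\dots,\mu_{k-1})}(X))\big)^{\mu_k}$ if $k\ge1$. Let $\binom{z}{k}_{\boldsymbol\mu}$ be the coefficient of $s^k$ in the polynomial of degree at most $k$ that interpolates $s\mapsto s^z$ at $\mu_0,\dots,\mu_k$ (with multiplicities, i.e. Hermite interpolation); for distinct $\mu_i$ it equals $\sum_{i}\mu_i^z/\prod_{j\ne i}(\mu_i-\mu_j)$. \textbf{Proposition.} Let $Y\in\mathcal D^m$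 and $z\in\mathbb C$. For each $k\in\mathbb N$ only finitely many $\boldsymbol\mu\in W(k)$ have $\nabla^{\boldsymbol\mu}(Y)\neq0$. For every $n\in\mathbb N$, $$\Delta^zY=\sum_{k=0}^n\ \sum_{\boldsymbol\mu\in W(k)}\binom{z}{k}_{\boldsymbol\mu}\nabla^{\boldsymbol\mu}(Y)\,\Delta^{z-k}+Q\qquad\text{for some } Q\in\mathrm{Op}^{\,r\operatorname{Re}(z)+m-n-1}.$$ The leading ($k=0$) term equals $\theta^{rz}(Y)\Delta^z$. Consequently $\Delta^zY$ has the asymptotic expansion $$\Delta^zY\sim\theta^{rz}(Y)\Delta^z+\sum_{k\ge1}\ \sum_{\boldsymbol\mu\in W(k)}\binom{z}{k}_{\boldsymbol\mu}\nabla^{\boldsymbol\mu}(Y)\Delta^{z-k},$$ i.e. $\Delta^zY$ and all the terms have finite analytic order (each lies in some $\mathrm{Op}^t$), and for every $l\in\mathbb R$ there is $N\in\mathbb N$ such that for all $n\ge N$ the difference of $\Delta^zY$ and the partial sum of the terms $k\le n$ lies in $\mathrm{Op}^l$. -/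

import Mathlib

open scoped InnerProductSpace

noncomputable section

/-! ### Diagonalizable linear maps -/

section Diagonalizable

variable {V : Type*} [AddCommGroup V] [Module ℂ V]

open scoped Classical in
/-- A linear map is diagonalizable if the space is the algebraic direct sum of its eigenspaces. -/
def IsDiagonalizable (T : Module.End ℂ V) : Prop :=
  DirectSum.IsInternal (fun c : ℂ => T.eigenspace c)

/-- All eigenvalues are strictly positive real numbers. -/
def HasPositiveEigenvalues (T : Module.End ℂ V) : Prop :=
  ∀ c : ℂ, T.HasEigenvalue c → ∃ x : ℝ, 0 < x ∧ c = (x : ℂ)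

theorem IsDiagonalizable.pow {T : Module.End ℂ V} (h : IsDiagonalizable T) (r : ℕ) :
    IsDiagonalizable (T ^ r) := by
  classical
  unfold IsDiagonalizable at h ⊢
  rw [DirectSum.isInternal_submodule_iff_iSupIndep_and_iSup_eq_top] at h ⊢
  refine ⟨Module.End.eigenspaces_iSupIndep _, ?_⟩
  rw [eq_top_iff, ← h.2]
  refine iSup_le fun c => le_trans ?_ (le_iSup _ (c ^ r))
  intro x hx
  rw [Module.End.mem_eigenspace_iff] at hx ⊢
  induction r with
  | zero => simp
  | succ k ih => rw [pow_succ, Module.End.mul_apply, hx, map_smul, ih, smul_smul, pow_succ']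

open scoped Classical in
/-- The projection onto the eigenspace with eigenvalue `c` along the other eigenspaces. -/
def eigenProj (T : Module.End ℂ V) (h : IsDiagonalizable T) (c : ℂ) : Module.End ℂ V :=
  (T.eigenspace c).subtype ∘ₗ
    DirectSum.component ℂ ℂ (fun c : ℂ => T.eigenspace c) c ∘ₗ
      (LinearEquiv.ofBijective
        (DirectSum.coeLinearMap (fun c : ℂ => T.eigenspace c)) h).symm.toLinearMap

/-- The complex power `T ^ z` of a diagonalizable map with positive eigenvalues:
multiplication by `c ^ z` on the eigenspace with eigenvalue `c`
(for each vector only finitely many summands are nonzero). -/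
def diagCPow (T : Module.End ℂ V) (h : IsDiagonalizable T) (z : ℂ) (x : V) : V :=
  ∑ᶠ c : ℂ, (c ^ z) • eigenProj T h c x

end Diagonalizable

/-! ### Generalized binomial coefficients -/

section Binomial

open Polynomial

/-- The multiplicity of `μ i` in the tuple `μ`. -/
def multiplicityIn {n : ℕ} (μ : Fin (n + 1) → ℂ) (i : Fin (n + 1)) : ℕ :=
  (Finset.univ.filter fun j => μ j = μ i).card

/-- `p` is a polynomial of degree at most `n` that agrees with `f` at each `μ i` to order
the multiplicity of `μ i` in `μ` (i.e. the derivatives of order `< mult (μ i)` agree). -/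
def IsHermiteInterpolant {n : ℕ} (f : ℂ → ℂ) (μ : Fin (n + 1) → ℂ) (p : ℂ[X]) : Prop :=
  p.natDegree ≤ n ∧ ∀ i, ∀ k < multiplicityIn μ i,
    (derivative^[k] p).eval (μ i) = iteratedDeriv k f (μ i)

theorem eq_zero_of_hermite_zero {n : ℕ} (μ : Fin (n + 1) → ℂ) (p : ℂ[X]) (hp : p.natDegree ≤ n)
    (h : ∀ i, ∀ k < multiplicityIn μ i, (derivative^[k] p).eval (μ i) = 0) : p = 0 := by
  classical
  by_contra h0
  have hle : Multiset.map μ Finset.univ.val ≤ p.roots := by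
    rw [Multiset.le_iff_count]
    intro a
    rw [Multiset.count_map, Polynomial.count_roots]
    by_cases ha : ∃ i, μ i = a
    · obtain ⟨i, rfl⟩ := ha
      have hc : (Multiset.filter (fun j => μ i = μ j) Finset.univ.val).card
          = multiplicityIn μ i := by
        unfold multiplicityIn
        simp only [Finset.card_def, Finset.filter_val, eq_comm]
      rw [hc]
      by_contra hlt
      rw [not_le] at hlt
      have := (Polynomial.lt_rootMultiplicity_iff_isRoot_iterate_derivative (t := μ i)
        (n := p.rootMultiplicity (μ i)) h0).2 (fun m hm => h i m (lt_of_le_of_lt hm hlt))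
      exact lt_irrefl _ this
    · rw [Multiset.filter_eq_nil.2]
      · simp
      · intro j _ hj
        exact ha ⟨j, hj.symm⟩
  have h1 := Multiset.card_le_card hle
  have h2 := p.card_roots'
  simp at h1
  omega

theorem exists_isHermiteInterpolant {n : ℕ} (f : ℂ → ℂ) (μ : Fin (n + 1) → ℂ) :
    ∃ p, IsHermiteInterpolant f μ p := by
  classical
  -- the order of the condition imposed by the `i`-th node
  let o : Fin (n + 1) → ℕ := fun i => (Finset.univ.filter fun j => j < i ∧ μ j = μ i).card
  have hcov : ∀ i, ∀ k < multiplicityIn μ i, ∃ j, μ j = μ i ∧ o j = k := by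
    intro i k hk
    let S := Finset.univ.filter fun j => μ j = μ i
    let e := S.orderEmbOfFin (k := multiplicityIn μ i) rfl
    have he : ∀ m, μ (e m) = μ i := fun m =>
      (Finset.mem_filter.1 (S.orderEmbOfFin_mem rfl m)).2
    refine ⟨e ⟨k, hk⟩, he _, ?_⟩
    have : (Finset.univ.filter fun j => j < e ⟨k, hk⟩ ∧ μ j = μ (e ⟨k, hk⟩))
        = (Finset.univ.filter fun m : Fin (multiplicityIn μ i) => m < ⟨k, hk⟩).map
            e.toEmbedding := by
      ext j
      simp only [Finset.mem_filter, Finset.mem_univ, true_and, Finset.mem_map,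
        RelEmbedding.coe_toEmbedding, he]
      constructor
      · rintro ⟨h1, h2⟩
        have hj : j ∈ Set.range e := by
          rw [show Set.range e = S from S.range_orderEmbOfFin rfl]
          simpa [S] using h2
        obtain ⟨m, rfl⟩ := hj
        exact ⟨m, e.lt_iff_lt.1 h1, rfl⟩
      · rintro ⟨m, hm, rfl⟩
        exact ⟨e.lt_iff_lt.2 hm, he m⟩
    simp only [o]
    rw [this, Finset.card_map]
    have : (Finset.univ.filter fun m : Fin (multiplicityIn μ i) => m < ⟨k, hk⟩)
        = Finset.Iio ⟨k, hk⟩ := by ext; simp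
    rw [this, Fin.card_Iio]
  let D : ℕ → ℂ[X] →ₗ[ℂ] ℂ[X] := fun k => (derivative : ℂ[X] →ₗ[ℂ] ℂ[X]) ^ k
  let L : Polynomial.degreeLT ℂ (n + 1) →ₗ[ℂ] (Fin (n + 1) → ℂ) :=
    LinearMap.pi fun i => (Polynomial.leval (μ i)) ∘ₗ D (o i) ∘ₗ
      (Polynomial.degreeLT ℂ (n + 1)).subtype
  have hL : ∀ p i, L p i = (derivative^[o i] (p : ℂ[X])).eval (μ i) := by
    intro p i
    simp [L, D, Module.End.pow_apply]
  have hdeg : ∀ p : Polynomial.degreeLT ℂ (n + 1), (p : ℂ[X]).natDegree ≤ n := by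
    intro p
    have := Polynomial.mem_degreeLT.1 p.2
    by_cases h0 : (p : ℂ[X]) = 0
    · simp [h0]
    · exact Nat.lt_succ_iff.1 ((Polynomial.natDegree_lt_iff_degree_lt h0).2 this)
  have hinj : Function.Injective L := by
    rw [← LinearMap.ker_eq_bot, LinearMap.ker_eq_bot']
    intro p hp
    apply Subtype.ext
    refine eq_zero_of_hermite_zero μ _ (hdeg p) fun i k hk => ?_
    obtain ⟨j, hj, rfl⟩ := hcov i k hk
    rw [← hj, ← hL, hp]
    rfl
  have hfin : Module.finrank ℂ (Polynomial.degreeLT ℂ (n + 1))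
      = Module.finrank ℂ (Fin (n + 1) → ℂ) :=
    (Polynomial.degreeLTEquiv ℂ (n + 1)).finrank_eq
  have : FiniteDimensional ℂ (Polynomial.degreeLT ℂ (n + 1)) :=
    Module.Finite.equiv (Polynomial.degreeLTEquiv ℂ (n + 1)).symm
  have hsurj := (LinearMap.injective_iff_surjective_of_finrank_eq_finrank hfin).1 hinj
  obtain ⟨p, hp⟩ := hsurj fun i => iteratedDeriv (o i) f (μ i)
  refine ⟨p, hdeg p, fun i k hk => ?_⟩
  obtain ⟨j, hj, rfl⟩ := hcov i k hk
  rw [← hj, ← hL, hp]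

/-- The interpolating polynomial is unique. -/
theorem IsHermiteInterpolant.unique {n : ℕ} {f : ℂ → ℂ} {μ : Fin (n + 1) → ℂ} {p q : ℂ[X]}
    (hp : IsHermiteInterpolant f μ p) (hq : IsHermiteInterpolant f μ q) : p = q := by
  refine sub_eq_zero.1 (eq_zero_of_hermite_zero μ _ ?_ fun i k hk => ?_)
  · exact (Polynomial.natDegree_sub_le p q).trans (max_le hp.1 hq.1)
  · rw [Polynomial.iterate_derivative_sub, Polynomial.eval_sub, hp.2 i k hk, hq.2 i k hk, sub_self]

/-- The Hermite interpolation polynomial of `f` at the nodes `μ`. -/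
def hermiteInterpolant {n : ℕ} (f : ℂ → ℂ) (μ : Fin (n + 1) → ℂ) : ℂ[X] :=
  (exists_isHermiteInterpolant f μ).choose

/-- The generalized binomial coefficient of `z` over `n` with respect to `μ = (μ₀, …, μₙ)`:
the coefficient of `s ^ n` (that is, `1 / n!` times the constant `n`-th derivative) of the
polynomial of degree at most `n` that agrees with `s ↦ s ^ z` at the nodes `μᵢ`, with
multiplicity.  For distinct `μᵢ` it is `∑ᵢ μᵢ ^ z / ∏_{j ≠ i} (μᵢ - μⱼ)`. -/
def muBinom (z : ℂ) (n : ℕ) (μ : Fin (n + 1) → ℝ) : ℂ :=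
  (hermiteInterpolant (fun s : ℂ => s ^ z) (fun i => (μ i : ℂ))).coeff n

end Binomial

/-! ### Abstract Laplace operators, Sobolev norms and operators of finite analytic order -/

/-- A strictly positive (unbounded) operator on a complex Hilbert space: a self-adjoint operator
that is bounded below by a positive constant. -/
structure AbstractLaplace (H : Type*) [NormedAddCommGroup H] [InnerProductSpace ℂ H]
    [CompleteSpace H] where
  /-- the operator with its domain -/
  toPMap : H →ₗ.[ℂ] H
  selfAdjoint : IsSelfAdjoint toPMap
  strictlyPositive : ∃ c : ℝ, 0 < c ∧
    ∀ x : toPMap.domain, c * ‖(x : H)‖ ^ 2 ≤ (⟪(x : H), toPMap x⟫_ℂ).re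

namespace AbstractLaplace

variable {H : Type*} [NormedAddCommGroup H] [InnerProductSpace ℂ H] [CompleteSpace H]
variable (Δ : AbstractLaplace H)

theorem exists_bound : ∃ c : ℝ, 0 < c ∧ ∀ x : Δ.toPMap.domain, c * ‖(x : H)‖ ≤ ‖Δ.toPMap x‖ := by
  obtain ⟨c, hc, h⟩ := Δ.strictlyPositive
  refine ⟨c, hc, fun x => ?_⟩
  have h1 := h x
  have h2 : (⟪(x : H), Δ.toPMap x⟫_ℂ).re ≤ ‖(x : H)‖ * ‖Δ.toPMap x‖ :=
    re_inner_le_norm (𝕜 := ℂ) (x : H) (Δ.toPMap x)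
  rcases eq_or_lt_of_le (norm_nonneg (x : H)) with h0 | h0
  · rw [← h0]; simp
  · nlinarith

theorem range_eq_top : LinearMap.range Δ.toPMap.toFun = ⊤ := by
  obtain ⟨c, hc, hb⟩ := Δ.exists_bound
  have hclosed : IsClosed (LinearMap.range Δ.toPMap.toFun : Set H) := by
    refine IsSeqClosed.isClosed fun u y hu hy => ?_
    choose x hx using hu
    have hx' : ∀ n, Δ.toPMap (x n) = u n := hx
    have hcau : CauchySeq fun n => (x n : H) := by
      rw [Metric.cauchySeq_iff']
      intro ε hε
      obtain ⟨N, hN⟩ := Metric.cauchySeq_iff'.1 hy.cauchySeq (c * ε) (by positivity)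
      refine ⟨N, fun n hn => ?_⟩
      have h1 := hb (x n - x N)
      rw [LinearPMap.map_sub, hx', hx', ← dist_eq_norm] at h1
      have h2 := lt_of_le_of_lt h1 (hN n hn)
      rw [dist_eq_norm]
      exact lt_of_mul_lt_mul_left (by simpa using h2) hc.le
    obtain ⟨a, ha⟩ := cauchySeq_tendsto_of_complete hcau
    have hcl : IsClosed (Δ.toPMap.graph : Set (H × H)) := Δ.selfAdjoint.isClosed
    have hmem : (a, y) ∈ (Δ.toPMap.graph : Set (H × H)) := by
      refine hcl.mem_of_tendsto (ha.prodMk_nhds hy) (Filter.Eventually.of_forall fun n => ?_)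
      exact LinearPMap.mem_graph_iff _ |>.2 ⟨x n, rfl, hx' n⟩
    obtain ⟨w, -, hw⟩ := (LinearPMap.mem_graph_iff _).1 hmem
    exact ⟨w, hw⟩
  have horth : (LinearMap.range Δ.toPMap.toFun)ᗮ = ⊥ := by
    rw [eq_bot_iff]
    intro y hy
    have hy' : ∀ x : Δ.toPMap.domain, ⟪(0 : H), (x : H)⟫_ℂ = ⟪y, Δ.toPMap x⟫_ℂ := by
      intro x
      rw [inner_zero_left]
      exact ((Submodule.mem_orthogonal' _ _).1 hy _ ⟨x, rfl⟩).symm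
    have hd := LinearPMap.mem_adjoint_domain_of_exists (T := Δ.toPMap) y ⟨0, hy'⟩
    have ha := LinearPMap.adjoint_apply_eq Δ.selfAdjoint.dense_domain ⟨y, hd⟩ hy'
    have hsa : Δ.toPMap.adjoint = Δ.toPMap := Δ.selfAdjoint
    have hg : (y, (0 : H)) ∈ Δ.toPMap.adjoint.graph :=
      (LinearPMap.mem_graph_iff _).2 ⟨⟨y, hd⟩, rfl, ha⟩
    rw [hsa] at hg
    obtain ⟨w, hw, hw0⟩ := (LinearPMap.mem_graph_iff _).1 hg
    have := hb w
    rw [hw0, norm_zero] at this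
    have h0 : ‖(w : H)‖ = 0 := by
      nlinarith [norm_nonneg (w : H)]
    have hw' : (w : H) = y := hw
    rw [Submodule.mem_bot, ← hw']
    exact norm_eq_zero.1 h0
  have := Submodule.topologicalClosure_eq_top_iff.2 horth
  rwa [hclosed.submodule_topologicalClosure_eq] at this

theorem exists_inverse : ∃ A : H →L[ℂ] H,
    (∀ x : Δ.toPMap.domain, A (Δ.toPMap x) = x) ∧
    ∀ y : H, ∃ hy : A y ∈ Δ.toPMap.domain, Δ.toPMap ⟨A y, hy⟩ = y := by
  obtain ⟨c, hc, hb⟩ := Δ.exists_bound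
  have hinj : Function.Injective Δ.toPMap.toFun := by
    rw [← LinearMap.ker_eq_bot, LinearMap.ker_eq_bot']
    intro x hx
    have hx0 : Δ.toPMap x = 0 := hx
    have := hb x
    rw [hx0, norm_zero] at this
    have h0 : ‖(x : H)‖ = 0 := by nlinarith [norm_nonneg (x : H)]
    exact Subtype.ext (norm_eq_zero.1 h0)
  let e := LinearEquiv.ofBijective Δ.toPMap.toFun
    ⟨hinj, LinearMap.range_eq_top.1 Δ.range_eq_top⟩
  have he : ∀ y, Δ.toPMap (e.symm y) = y := fun y => e.apply_symm_apply y
  refine ⟨(Δ.toPMap.domain.subtype ∘ₗ e.symm.toLinearMap).mkContinuous c⁻¹ fun y => ?_, ?_, ?_⟩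
  · have := hb (e.symm y)
    rw [he] at this
    rw [inv_mul_eq_div, le_div_iff₀ hc, mul_comm]
    exact this
  · intro x
    exact congrArg Subtype.val (e.symm_apply_apply x)
  · intro y
    exact ⟨(e.symm y).2, he y⟩

/-- The bounded inverse `Δ⁻¹ : H → dom Δ ⊆ H`. -/
def inv : H →L[ℂ] H := Δ.exists_inverse.choose

theorem inv_apply (x : Δ.toPMap.domain) : Δ.inv (Δ.toPMap x) = x :=
  Δ.exists_inverse.choose_spec.1 x

theorem inv_mem (y : H) : Δ.inv y ∈ Δ.toPMap.domain :=
  (Δ.exists_inverse.choose_spec.2 y).1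

theorem apply_inv (y : H) : Δ.toPMap ⟨Δ.inv y, Δ.inv_mem y⟩ = y :=
  (Δ.exists_inverse.choose_spec.2 y).2

/-- The domain of `Δ ^ n`. -/
def powDomain : ℕ → Submodule ℂ H
  | 0 => ⊤
  | n + 1 => ((powDomain n).comap Δ.toPMap.toFun).map Δ.toPMap.domain.subtype

theorem mem_powDomain_succ {n : ℕ} {x : H} :
    x ∈ Δ.powDomain (n + 1) ↔ ∃ hx : x ∈ Δ.toPMap.domain, Δ.toPMap ⟨x, hx⟩ ∈ Δ.powDomain n := by
  constructor
  · rintro ⟨w, hw, rfl⟩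
    exact ⟨w.2, hw⟩
  · rintro ⟨hx, h⟩
    exact ⟨⟨x, hx⟩, h, rfl⟩

/-- `H^∞`, the common domain of all powers of `Δ`. -/
def smooth : Submodule ℂ H := ⨅ n, Δ.powDomain n

theorem mem_domain_of_mem_smooth {x : H} (hx : x ∈ Δ.smooth) : x ∈ Δ.toPMap.domain :=
  (Δ.mem_powDomain_succ.1 ((Submodule.mem_iInf _).1 hx 1)).1

theorem apply_mem_smooth {x : H} (hx : x ∈ Δ.smooth) :
    Δ.toPMap ⟨x, Δ.mem_domain_of_mem_smooth hx⟩ ∈ Δ.smooth :=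
  (Submodule.mem_iInf _).2 fun n =>
    (Δ.mem_powDomain_succ.1 ((Submodule.mem_iInf _).1 hx (n + 1))).2

/-- `Δ` as a linear operator on `H^∞`. -/
def op : Module.End ℂ Δ.smooth where
  toFun x := ⟨Δ.toPMap ⟨x, Δ.mem_domain_of_mem_smooth x.2⟩, Δ.apply_mem_smooth x.2⟩
  map_add' x y := Subtype.ext (Δ.toPMap.map_add ⟨x, _⟩ ⟨y, _⟩)
  map_smul' a x := Subtype.ext (Δ.toPMap.map_smul a ⟨x, _⟩)

/-- Bounded operators that commute with `Δ⁻¹` preserve `H^∞`. -/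
theorem map_mem_smooth {B : H →L[ℂ] H} (hB : Commute B Δ.inv) {x : H} (hx : x ∈ Δ.smooth) :
    B x ∈ Δ.smooth := by
  refine (Submodule.mem_iInf _).2 fun n => ?_
  replace hx := (Submodule.mem_iInf _).1 hx n
  induction n generalizing x with
  | zero => exact Submodule.mem_top
  | succ n ih =>
    obtain ⟨hd, hm⟩ := Δ.mem_powDomain_succ.1 hx
    have key : B x = Δ.inv (B (Δ.toPMap ⟨x, hd⟩)) := by
      have h := congrArg (fun C : H →L[ℂ] H => C (Δ.toPMap ⟨x, hd⟩)) hB.eq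
      simp only [mul_apply_eq_comp, Δ.inv_apply] at h
      exact h
    rw [key]
    refine Δ.mem_powDomain_succ.2 ⟨Δ.inv_mem _, ?_⟩
    rw [Δ.apply_inv]
    exact ih hm

/-- The bounded operator `Δ ^ (-s)` for `Re s > 0`: the continuous function `t ↦ t ^ s` of the
bounded positive operator `Δ⁻¹`. -/
def invCPow (s : ℂ) : H →L[ℂ] H := cfc (fun t : ℂ => t ^ s) Δ.inv

theorem commute_invCPow (s : ℂ) : Commute (Δ.invCPow s) Δ.inv := by
  by_cases h : IsStarNormal Δ.inv
  · have := cfc_commute_cfc (R := ℂ) (fun t : ℂ => t ^ s) id Δ.inv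
    rwa [cfc_id ℂ Δ.inv] at this
  · rw [invCPow, cfc_apply_of_not_predicate _ h]
    exact Commute.zero_left _

/-- The complex power `Δ ^ z` as a linear operator on `H^∞`: it is `Δ ^ (-(N - z)) Δ ^ N`
for a natural number `N > Re z`. -/
def cpow (z : ℂ) : Module.End ℂ Δ.smooth :=
  ((Δ.invCPow ((⌊z.re⌋₊ + 1 : ℕ) - z)).toLinearMap.restrict
    fun _ hx => Δ.map_mem_smooth (Δ.commute_invCPow _) hx) * Δ.op ^ (⌊z.re⌋₊ + 1)

/-- The norm of the Sobolev space `H^s`, `‖v‖_s = ‖Δ ^ (s / r) v‖`, on its dense subspace `H^∞`. -/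
def sobolevNorm (r : ℕ) (s : ℝ) (v : Δ.smooth) : ℝ := ‖(Δ.cpow ((s : ℂ) / r) v : H)‖

/-- `Op^t`: the linear operators on `H^∞` that are bounded from the `H^s`-norm to the
`H^(s - t)`-norm for every real `s`.  As `H^s` is the completion of `H^∞` in the `H^s`-norm, this
says that the operator extends to a bounded operator `H^s → H^(s - t)`. -/
def Op (r : ℕ) (t : ℝ) : Set (Module.End ℂ Δ.smooth) :=
  {T | ∀ s : ℝ, ∃ C : ℝ, ∀ v : Δ.smooth,
    Δ.sobolevNorm r (s - t) (T v) ≤ C * Δ.sobolevNorm r s v}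

/-- `P ∼ ∑ Pₙ`, for operators of finite analytic order. -/
def HasAsymptoticExpansion (r : ℕ) (P : Module.End ℂ Δ.smooth)
    (p : ℕ → Module.End ℂ Δ.smooth) : Prop :=
  (∃ t, P ∈ Δ.Op r t) ∧ (∀ k, ∃ t, p k ∈ Δ.Op r t) ∧
    ∀ l : ℝ, ∃ N : ℕ, ∀ n ≥ N, P - ∑ k ∈ Finset.range (n + 1), p k ∈ Δ.Op r l

end AbstractLaplace

/-! ### Twisted algebras of abstract differential operators -/

/-- A twisted algebra of abstract differential operators associated to `Δ`, the latter of
order `r`. -/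
structure TwistedDOAlgebra {H : Type*} [NormedAddCommGroup H] [InnerProductSpace ℂ H]
    [CompleteSpace H] (Δ : AbstractLaplace H) (r : ℕ) where
  /-- the algebra of operators on `H^∞` (closed under products by `mul_mem_filt`) -/
  carrier : Submodule ℂ (Module.End ℂ Δ.smooth)
  /-- its filtration by order -/
  filt : ℕ → Submodule ℂ (Module.End ℂ Δ.smooth)
  filt_mono : Monotone filt
  mem_carrier_iff : ∀ X, X ∈ carrier ↔ ∃ m, X ∈ filt m
  mul_mem_filt : ∀ m n X Y, X ∈ filt m → Y ∈ filt n → X * Y ∈ filt (m + n)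
  /-- the twisting: a linear automorphism, not necessarily multiplicative -/
  twist : carrier ≃ₗ[ℂ] carrier
  twist_mem : ∀ (m : ℕ) (X : carrier), (X : Module.End ℂ Δ.smooth) ∈ filt m →
    (twist X : Module.End ℂ Δ.smooth) ∈ filt m
  /-- the twisted commutator with `Δ` raises the order by at most `r - 1` -/
  commutator_mem : ∀ (m : ℕ) (X : carrier), (X : Module.End ℂ Δ.smooth) ∈ filt m →
    Δ.op * (X : Module.End ℂ Δ.smooth) -
      (((twist.toLinearMap : Module.End ℂ carrier) ^ r) X : Module.End ℂ Δ.smooth) * Δ.op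
        ∈ filt (m + (r - 1))
  /-- the elliptic estimate -/
  elliptic : ∀ (m : ℕ), ∀ X ∈ filt m, ∃ C : ℝ, 0 < C ∧ ∀ v : Δ.smooth,
    ‖(X v : H)‖ ≤ C * ‖(Δ.cpow ((m : ℂ) / r) v : H)‖

namespace TwistedDOAlgebra

variable {H : Type*} [NormedAddCommGroup H] [InnerProductSpace ℂ H] [CompleteSpace H]
variable {Δ : AbstractLaplace H} {r : ℕ} (𝒟 : TwistedDOAlgebra Δ r)

/-- The vector space underlying the algebra `𝒟`. -/
def Alg : Type _ := 𝒟.carrier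

instance : AddCommGroup 𝒟.Alg := inferInstanceAs (AddCommGroup 𝒟.carrier)

instance : Module ℂ 𝒟.Alg := inferInstanceAs (Module ℂ 𝒟.carrier)

/-- The inclusion of `𝒟` into the linear operators on `H^∞`. -/
def toEnd : 𝒟.Alg →ₗ[ℂ] Module.End ℂ Δ.smooth := 𝒟.carrier.subtype

/-- The twisting `θ` as an endomorphism of the vector space `𝒟`. -/
def θ : Module.End ℂ 𝒟.Alg := 𝒟.twist.toLinearMap

theorem commutator_mem_carrier (X : 𝒟.Alg) :
    Δ.op * 𝒟.toEnd X - 𝒟.toEnd ((𝒟.θ ^ r) X) * Δ.op ∈ 𝒟.carrier := by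
  obtain ⟨m, hm⟩ := (𝒟.mem_carrier_iff _).1 X.2
  exact (𝒟.mem_carrier_iff _).2 ⟨_, 𝒟.commutator_mem m X hm⟩

/-- The twisted commutator `∇ X = Δ X - θ ^ r (X) Δ`. -/
def nabla (X : 𝒟.Alg) : 𝒟.Alg :=
  ⟨Δ.op * 𝒟.toEnd X - 𝒟.toEnd ((𝒟.θ ^ r) X) * Δ.op, 𝒟.commutator_mem_carrier X⟩

/-- The set `W` of weights, the eigenvalues of `θ ^ r` (used only when these are positive reals). -/
def weights : Set ℝ := {μ | (𝒟.θ ^ r).HasEigenvalue (μ : ℂ)}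

/-- The component `X^μ` of weight `μ` of `X`. -/
def weightComponent (h : IsDiagonalizable 𝒟.θ) (μ : ℝ) (X : 𝒟.Alg) : 𝒟.Alg :=
  eigenProj (𝒟.θ ^ r) (h.pow r) (μ : ℂ) X

/-- The iterated twisted commutator `∇^μ X`: take `∇` and project to the next weight, in turn. -/
def nablaMulti (h : IsDiagonalizable 𝒟.θ) :
    (k : ℕ) → (Fin (k + 1) → ℝ) → 𝒟.Alg → 𝒟.Alg
  | 0, μ, X => 𝒟.weightComponent h (μ 0) X
  | k + 1, μ, X => 𝒟.weightComponent h (μ (Fin.last (k + 1)))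
      (𝒟.nabla (nablaMulti h k (Fin.init μ) X))

/-- The `k`-th term `∑_{μ ∈ W(k)} (z over k)_μ ∇^μ(Y) Δ ^ (z - k)` of the expansion, where `W(k)` is
the set of `(k + 1)`-tuples of weights. -/
def expansionTerm (h : IsDiagonalizable 𝒟.θ) (z : ℂ) (Y : 𝒟.Alg) (k : ℕ) :
    Module.End ℂ Δ.smooth :=
  ∑ᶠ μ : Fin (k + 1) → 𝒟.weights, muBinom z k (fun i => (μ i : ℝ)) •
    (𝒟.toEnd (𝒟.nablaMulti h k (fun i => (μ i : ℝ)) Y) * Δ.cpow (z - k))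

end TwistedDOAlgebra

end

open scoped InnerProductSpace

noncomputable section

namespace AbstractLaplace

variable {H : Type*} [NormedAddCommGroup H] [InnerProductSpace ℂ H] [CompleteSpace H]
variable (Δ : AbstractLaplace H)

/-! ### The bounded inverse -/

/-! The expansion comes from commuting resolvents past `Y`. If `X` has weight `μ`, then `(x + Δ) X =
X (x + μ Δ) + ∇X`, hence `(x + Δ)⁻¹ X = X (x + μ Δ)⁻¹ - (x + Δ)⁻¹ ∇X (x + μ Δ)⁻¹`. Splitting `∇X`
into weights and iterating puts products of resolvents `(x + μᵢ Δ)⁻¹` to the right of iterated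
twisted commutators.

For `0 < Re a < 1`, integrating `x ^ (-a) (x + Δ)⁻¹` over `x > 0` gives a nonzero multiple of `Δ ^
(-a)`. By homogeneity, the integral of `x ^ (-a) ∏ (x + μᵢ Δ)⁻¹` over `k + 1` nodes is a scalar
times `Δ ^ (-a - k)`. The resolvent identity shows that these scalars are, up to sign and
normalisation, the divided differences of `s ^ (-a)` (`dslope_eq_stieltjes`), and these are the
generalized binomial coefficients (`muBinom_eq_divDiff`). The elliptic estimate bounds the remaining
integral, which proves the expansion for `z = -a` as an estimate into `H`
(`exists_norm_resIntegral_sub_le`, `hasExpansion_of_strip`).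

The other exponents follow algebraically. Sums over tuples of weights are packaged as linear maps
`coeffMap k f`, which are defined on weight vectors by peeling off the first weight, and the Leibniz
rule for divided differences is `coeffMap_mul`. It yields `remainder_add`, an identity expressing
the remainder for `z + w` by those for `z` and `w`. Adding exponents from the strip reaches `Re z <
0`. For `z = 1` the expansion is the exact identity `Δ Y = θ ^ r (Y) Δ + ∇Y`, so adding `1`
repeatedly reaches all `z`.

Finally, `Op` membership requires bounds on `Δ ^ w` times the remainder for real `w`. The same
identity writes this product through the remainders for `w + z` and `w`, so estimates into `H` for
all exponents give all Sobolev bounds (`remainder_mem_Op`). -/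

theorem inner_apply_symm (x y : Δ.toPMap.domain) :
    ⟪Δ.toPMap x, (y : H)⟫_ℂ = ⟪(x : H), Δ.toPMap y⟫_ℂ := by
  have h := LinearPMap.adjoint_isFormalAdjoint (T := Δ.toPMap) Δ.selfAdjoint.dense_domain
  have hsa : Δ.toPMap.adjoint = Δ.toPMap := Δ.selfAdjoint
  rw [hsa] at h
  exact h x y

theorem isPositive_inv : Δ.inv.IsPositive := by
  obtain ⟨c, hc, hp⟩ := Δ.strictlyPositive
  rw [ContinuousLinearMap.isPositive_def']
  constructor
  · rw [ContinuousLinearMap.isSelfAdjoint_iff_isSymmetric]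
    intro x y
    have := Δ.inner_apply_symm ⟨_, Δ.inv_mem x⟩ ⟨_, Δ.inv_mem y⟩
    rw [Δ.apply_inv, Δ.apply_inv] at this
    exact this.symm
  · intro x
    have h := hp ⟨_, Δ.inv_mem x⟩
    rw [Δ.apply_inv] at h
    rw [ContinuousLinearMap.reApplyInnerSelf]
    exact le_trans (by positivity) h

theorem isSelfAdjoint_inv : IsSelfAdjoint Δ.inv := Δ.isPositive_inv.isSelfAdjoint

theorem isStarNormal_inv : IsStarNormal Δ.inv := Δ.isSelfAdjoint_inv.isStarNormal

open scoped ComplexOrder in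
-- Reduces the functional calculus of `Δ⁻¹` to real `t` in a bounded interval. The point `0` cannot
-- be excluded, since `Δ` may be unbounded.
theorem spectrum_inv {t : ℂ} (ht : t ∈ spectrum ℂ Δ.inv) :
    ∃ x : ℝ, 0 ≤ x ∧ x ≤ ‖Δ.inv‖ ∧ t = x := by
  have h0 : (0 : H →L[ℂ] H) ≤ Δ.inv :=
    (ContinuousLinearMap.nonneg_iff_isPositive _).2 Δ.isPositive_inv
  have h1 : t = t.re := Δ.isSelfAdjoint_inv.mem_spectrum_eq_re ht
  have h2 : 0 ≤ t := spectrum_nonneg_of_nonneg h0 ht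
  have h3 : ‖t‖ ≤ ‖Δ.inv‖ := by
    by_cases hn : Nontrivial (H →L[ℂ] H)
    · exact spectrum.norm_le_norm_of_mem ht
    · rw [not_nontrivial_iff_subsingleton] at hn
      simp at ht
  refine ⟨t.re, (Complex.nonneg_iff.1 h2).1, (Complex.re_le_norm t).trans h3, h1⟩

theorem continuousOn_cpow_spectrum {s : ℂ} (hs : 0 < s.re) :
    ContinuousOn (fun t : ℂ => t ^ s) (spectrum ℂ Δ.inv) := by
  intro t ht
  obtain ⟨x, hx, -, rfl⟩ := Δ.spectrum_inv ht
  exact (Complex.continuousAt_cpow_const_of_re_pos (Or.inl (by simpa using hx))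
    hs).continuousWithinAt

theorem invCPow_mul {s w : ℂ} (hs : 0 < s.re) (hw : 0 < w.re) :
    Δ.invCPow s * Δ.invCPow w = Δ.invCPow (s + w) := by
  rw [invCPow, invCPow, ← cfc_mul _ _ _ (Δ.continuousOn_cpow_spectrum hs)
    (Δ.continuousOn_cpow_spectrum hw)]
  refine cfc_congr fun t _ => ?_
  rcases eq_or_ne t 0 with rfl | h0
  -- The law of exponents needs a nonzero base; at `0` both sides vanish because the exponents have
  -- positive real part.
  · have h1 : s ≠ 0 := by rintro rfl; simp at hs
    have h2 : w ≠ 0 := by rintro rfl; simp at hw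
    have h3 : s + w ≠ 0 := by
      intro h
      have := congrArg Complex.re h
      simp at this
      linarith
    rw [Complex.zero_cpow h1, Complex.zero_cpow h3, zero_mul]
  · rw [Complex.cpow_add _ _ h0]

theorem invCPow_one : Δ.invCPow 1 = Δ.inv := by
  have := Δ.isStarNormal_inv
  rw [invCPow]
  simp only [Complex.cpow_one]
  exact cfc_id' ℂ Δ.inv

/-- Functions of `Δ⁻¹` with equal absolute values have equal norms on each vector. -/
theorem norm_cfc_apply_eq {f g : ℂ → ℂ} (hf : ContinuousOn f (spectrum ℂ Δ.inv))
    (hg : ContinuousOn g (spectrum ℂ Δ.inv)) (h : ∀ t ∈ spectrum ℂ Δ.inv, ‖f t‖ = ‖g t‖) (v : H) :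
    ‖cfc f Δ.inv v‖ = ‖cfc g Δ.inv v‖ := by
  have key : ∀ f : ℂ → ℂ, ContinuousOn f (spectrum ℂ Δ.inv) →
      ‖cfc f Δ.inv v‖ ^ 2 = (⟪cfc (fun t => star (f t) * f t) Δ.inv v, v⟫_ℂ).re := by
    intro f hf
    rw [cfc_mul _ _ _ hf.star hf, cfc_star, ContinuousLinearMap.star_eq_adjoint,
      mul_apply_eq_comp, ContinuousLinearMap.adjoint_inner_left]
    exact (inner_self_eq_norm_sq (𝕜 := ℂ) _).symm
  have h2 : ‖cfc f Δ.inv v‖ ^ 2 = ‖cfc g Δ.inv v‖ ^ 2 := by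
    rw [key f hf, key g hg, cfc_congr (f := fun t => star (f t) * f t)
      (g := fun t => star (g t) * g t)]
    intro t ht
    dsimp only
    have hc : ∀ w : ℂ, star w * w = ((‖w‖ ^ 2 : ℝ) : ℂ) := fun w => by
      rw [Complex.ofReal_pow, ← Complex.conj_mul']; rfl
    rw [hc, hc, h t ht]
  exact (sq_eq_sq₀ (norm_nonneg _) (norm_nonneg _)).1 h2

/-- On the nonnegative spectrum `t ^ s` and `t ^ (Re s)` have the same modulus; imaginary parts of
exponents therefore never affect orders. -/
theorem norm_invCPow_apply {s : ℂ} (hs : 0 < s.re) (v : H) :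
    ‖Δ.invCPow s v‖ = ‖Δ.invCPow s.re v‖ := by
  refine Δ.norm_cfc_apply_eq (Δ.continuousOn_cpow_spectrum hs)
    (Δ.continuousOn_cpow_spectrum (by simpa using hs)) (fun t ht => ?_) v
  obtain ⟨x, hx, -, rfl⟩ := Δ.spectrum_inv ht
  rw [Complex.norm_cpow_eq_rpow_re_of_nonneg hx hs.ne',
    Complex.norm_cpow_eq_rpow_re_of_nonneg hx (by simpa using hs.ne')]
  simp

/-! ### Functions of the bounded inverse as operators on `H^∞` -/

/-- The restriction to `H^∞` of a bounded operator commuting with `Δ⁻¹`. -/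
def restr (B : H →L[ℂ] H) (hB : Commute B Δ.inv) : Module.End ℂ Δ.smooth :=
  B.toLinearMap.restrict fun _ hx => Δ.map_mem_smooth hB hx

@[simp]
theorem coe_restr (B : H →L[ℂ] H) (hB : Commute B Δ.inv) (v : Δ.smooth) :
    (Δ.restr B hB v : H) = B v := rfl

theorem inv_op (v : Δ.smooth) : Δ.inv (Δ.op v) = v :=
  Δ.inv_apply ⟨v, Δ.mem_domain_of_mem_smooth v.2⟩

theorem restr_inv_mul_op : Δ.restr Δ.inv (Commute.refl _) * Δ.op = 1 :=
  LinearMap.ext fun v => Subtype.ext (Δ.inv_op v)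

theorem op_mul_restr_inv : Δ.op * Δ.restr Δ.inv (Commute.refl _) = 1 :=
  LinearMap.ext fun v => Subtype.ext (Δ.apply_inv v)

theorem restr_mul (B C : H →L[ℂ] H) (hB : Commute B Δ.inv) (hC : Commute C Δ.inv) :
    Δ.restr B hB * Δ.restr C hC = Δ.restr (B * C) (hB.mul_left hC) := rfl

/-- On `H^∞` the operators `Δ` and `Δ⁻¹` are two-sided inverses, so commuting with one gives
commuting with the other. -/
theorem restr_commute_op (B : H →L[ℂ] H) (hB : Commute B Δ.inv) : Commute (Δ.restr B hB) Δ.op := by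
  have h : Commute (Δ.restr B hB) (Δ.restr Δ.inv (Commute.refl _)) :=
    LinearMap.ext fun v => Subtype.ext (congrArg (fun C : H →L[ℂ] H => C v) hB.eq)
  calc Δ.restr B hB * Δ.op
      = Δ.op * Δ.restr Δ.inv (Commute.refl _) * (Δ.restr B hB * Δ.op) := by
        rw [op_mul_restr_inv, one_mul]
    _ = Δ.op * (Δ.restr B hB * Δ.restr Δ.inv (Commute.refl _)) * Δ.op := by
        rw [h.eq]; simp only [mul_assoc]
    _ = Δ.op * Δ.restr B hB := by
        rw [mul_assoc, mul_assoc, restr_inv_mul_op, mul_one]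

/-! ### Complex powers -/

theorem lt_floor_add_one (z : ℂ) : z.re < (⌊z.re⌋₊ + 1 : ℕ) := by
  push_cast; exact Nat.lt_floor_add_one _

/-- Raising the auxiliary exponent by one inserts `Δ⁻¹ Δ = 1`. The freedom in `N` is what makes the
exponent laws provable. -/
theorem cpow_eq_restr_mul (z : ℂ) (N : ℕ) (hN : z.re < N) :
    Δ.cpow z = Δ.restr (Δ.invCPow (N - z)) (Δ.commute_invCPow _) * Δ.op ^ N := by
  have step : ∀ M : ℕ, z.re < M → ∀ k : ℕ,
      Δ.restr (Δ.invCPow (M - z)) (Δ.commute_invCPow _) * Δ.op ^ M =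
        Δ.restr (Δ.invCPow ((M + k : ℕ) - z)) (Δ.commute_invCPow _) * Δ.op ^ (M + k) := by
    intro M hM k
    induction k with
    | zero => rfl
    | succ k ih =>
      have hpos : 0 < (((M + k : ℕ) : ℂ) - z).re := by
        simp; linarith [(Nat.cast_nonneg k : (0 : ℝ) ≤ k)]
      have h1 : Δ.invCPow ((M + (k + 1) : ℕ) - z) = Δ.invCPow ((M + k : ℕ) - z) * Δ.inv := by
        rw [← invCPow_one, invCPow_mul _ hpos (by simp)]
        congr 1
        push_cast
        ring
      have h2 : Δ.restr (Δ.invCPow ((M + (k + 1) : ℕ) - z)) (Δ.commute_invCPow _) =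
          Δ.restr (Δ.invCPow ((M + k : ℕ) - z)) (Δ.commute_invCPow _) *
            Δ.restr Δ.inv (Commute.refl _) := by
        rw [restr_mul]
        congr 1
      rw [ih, h2, ← add_assoc, pow_succ', mul_assoc, ← mul_assoc (Δ.restr Δ.inv _),
        restr_inv_mul_op, one_mul]
  have e1 : Δ.cpow z = Δ.restr (Δ.invCPow ((⌊z.re⌋₊ + 1 : ℕ) - z)) (Δ.commute_invCPow _) *
      Δ.op ^ (⌊z.re⌋₊ + 1) := rfl
  -- Both auxiliary exponents are raised to their sum.
  rw [e1, step _ (lt_floor_add_one z) N, step N hN (⌊z.re⌋₊ + 1)]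
  congr 2
  · rw [add_comm]
  · rw [add_comm]

theorem cpow_add (z w : ℂ) : Δ.cpow (z + w) = Δ.cpow z * Δ.cpow w := by
  have hz := lt_floor_add_one z
  have hw := lt_floor_add_one w
  rw [Δ.cpow_eq_restr_mul z _ hz, Δ.cpow_eq_restr_mul w _ hw,
    Δ.cpow_eq_restr_mul (z + w) ((⌊z.re⌋₊ + 1) + (⌊w.re⌋₊ + 1))
      (by rw [Nat.cast_add, Complex.add_re]; linarith)]
  set N := ⌊z.re⌋₊ + 1
  set M := ⌊w.re⌋₊ + 1
  have hc := (Δ.restr_commute_op (Δ.invCPow (M - w)) (Δ.commute_invCPow _)).pow_right N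
  have h1 : Δ.restr (Δ.invCPow ((N + M : ℕ) - (z + w))) (Δ.commute_invCPow _) =
      Δ.restr (Δ.invCPow (N - z)) (Δ.commute_invCPow _) *
        Δ.restr (Δ.invCPow (M - w)) (Δ.commute_invCPow _) := by
    rw [restr_mul]
    congr 1
    rw [invCPow_mul _ (by simpa using hz) (by simpa using hw)]
    congr 1
    push_cast
    ring
  rw [h1, pow_add, mul_assoc, mul_assoc, ← mul_assoc _ (Δ.op ^ N), hc.eq, mul_assoc]

theorem cpow_zero : Δ.cpow 0 = 1 := by
  rw [Δ.cpow_eq_restr_mul 0 1 (by simp), pow_one, ← restr_inv_mul_op]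
  congr 2
  simp [invCPow_one]

theorem cpow_one : Δ.cpow 1 = Δ.op := by
  rw [Δ.cpow_eq_restr_mul 1 2 (by simp), pow_two, ← mul_assoc]
  have : Δ.restr (Δ.invCPow ((2 : ℕ) - 1)) (Δ.commute_invCPow _) =
      Δ.restr Δ.inv (Commute.refl _) := by
    congr 1
    rw [← invCPow_one]
    norm_num
  rw [this, restr_inv_mul_op, one_mul]

theorem coe_cpow_neg (s : ℂ) (hs : 0 < s.re) (v : Δ.smooth) :
    (Δ.cpow (-s) v : H) = Δ.invCPow s v := by
  rw [Δ.cpow_eq_restr_mul (-s) 0 (by simpa using hs), pow_zero, mul_one]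
  simp

theorem norm_cpow (z : ℂ) (v : Δ.smooth) : ‖(Δ.cpow z v : H)‖ = ‖(Δ.cpow z.re v : H)‖ := by
  have hz := lt_floor_add_one z
  rw [Δ.cpow_eq_restr_mul z _ hz, Δ.cpow_eq_restr_mul z.re (⌊z.re⌋₊ + 1) (by simpa using hz)]
  simp only [Module.End.mul_apply, coe_restr]
  rw [norm_invCPow_apply _ (by simpa using hz)]
  simp

/-- For `Re p < Re q` the operator `Δ ^ (p - q)` is bounded; for equal real parts the two norms
agree. -/
theorem exists_norm_cpow_le {p q : ℂ} (h : p.re ≤ q.re) :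
    ∃ C : ℝ, 0 ≤ C ∧ ∀ v : Δ.smooth, ‖(Δ.cpow p v : H)‖ ≤ C * ‖(Δ.cpow q v : H)‖ := by
  rcases h.eq_or_lt with h | h
  · refine ⟨1, zero_le_one, fun v => ?_⟩
    rw [norm_cpow, h, ← norm_cpow, one_mul]
  · refine ⟨‖Δ.invCPow (q - p)‖, norm_nonneg _, fun v => ?_⟩
    have : p = -(q - p) + q := by ring
    conv_lhs => rw [this, cpow_add, Module.End.mul_apply, coe_cpow_neg _ _ (by simpa using h)]
    exact ContinuousLinearMap.le_opNorm _ _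

/-- A linear map on `H^∞` that is bounded in the norm of `H` extends to `H`. -/
theorem exists_extension (L : Δ.smooth →ₗ[ℂ] H) (C : ℝ) (hL : ∀ v, ‖L v‖ ≤ C * ‖(v : H)‖) :
    ∃ B : H →L[ℂ] H, ∀ v : Δ.smooth, B v = L v := by
  -- Extending to the closure and composing with the orthogonal projection makes a density proof for
  -- `H^∞` unnecessary.
  let K := Δ.smooth.topologicalClosure
  let e : Δ.smooth →ₗ[ℂ] K := Submodule.inclusion Δ.smooth.le_topologicalClosure
  have hd : DenseRange e := denseRange_inclusion_iff (s := (Δ.smooth : Set H)) (t := K)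
    Δ.smooth.le_topologicalClosure |>.2 subset_rfl
  refine ⟨(L.extendOfNorm e) ∘L K.orthogonalProjectionOnto, fun v => ?_⟩
  have : K.orthogonalProjectionOnto (v : H) = e v :=
    Submodule.orthogonalProjectionOnto_mem_subspace_eq_self (K := K) (e v)
  rw [ContinuousLinearMap.comp_apply, this]
  exact LinearMap.extendOfNorm_eq hd ⟨C, hL⟩ v

end AbstractLaplace

/-! ### Diagonalizable maps: decomposition into eigenvectors -/

section Diagonalizable

variable {V W : Type*} [AddCommGroup V] [Module ℂ V] [AddCommGroup W] [Module ℂ W]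
variable {T : Module.End ℂ V}

open scoped Classical in
/-- The linear map that is `g c` on the eigenspace with eigenvalue `c`. -/
def eigenLift (h : IsDiagonalizable T) (g : ℂ → V →ₗ[ℂ] W) : V →ₗ[ℂ] W :=
  DirectSum.toModule ℂ ℂ W (fun c => g c ∘ₗ (T.eigenspace c).subtype) ∘ₗ
    (LinearEquiv.ofBijective
      (DirectSum.coeLinearMap (fun c : ℂ => T.eigenspace c)) h).symm.toLinearMap

open scoped Classical in
theorem symm_coeLinearMap_of_mem (h : IsDiagonalizable T) {c : ℂ} {x : V}
    (hx : x ∈ T.eigenspace c) :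
    (LinearEquiv.ofBijective (DirectSum.coeLinearMap (fun c : ℂ => T.eigenspace c)) h).symm x =
      DirectSum.lof ℂ ℂ (fun c : ℂ => T.eigenspace c) c ⟨x, hx⟩ := by
  exact (LinearEquiv.symm_apply_eq _).2
    (DirectSum.coeLinearMap_lof (fun c : ℂ => T.eigenspace c) c ⟨x, hx⟩).symm

theorem eigenLift_apply (h : IsDiagonalizable T) (g : ℂ → V →ₗ[ℂ] W) {c : ℂ} {x : V}
    (hx : x ∈ T.eigenspace c) : eigenLift h g x = g c x := by
  classical
  rw [eigenLift, LinearMap.comp_apply, LinearEquiv.coe_coe, symm_coeLinearMap_of_mem h hx,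
    DirectSum.toModule_lof]
  rfl

theorem eigenProj_of_mem (h : IsDiagonalizable T) {c : ℂ} {x : V} (hx : x ∈ T.eigenspace c) :
    eigenProj T h c x = x := by
  classical
  rw [eigenProj, LinearMap.comp_apply, LinearMap.comp_apply, LinearEquiv.coe_coe,
    symm_coeLinearMap_of_mem h hx, DirectSum.component.lof_self]
  rfl

theorem eigenProj_of_mem_of_ne (h : IsDiagonalizable T) {c d : ℂ} {x : V}
    (hx : x ∈ T.eigenspace c) (hd : d ≠ c) : eigenProj T h d x = 0 := by
  classical
  rw [eigenProj, LinearMap.comp_apply, LinearMap.comp_apply, LinearEquiv.coe_coe,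
    symm_coeLinearMap_of_mem h hx, DirectSum.component.of, dif_neg hd.symm, map_zero]

/-- Applying `T - a` removes the summand of eigenvalue `a` and multiplies each other one by the
nonzero number `c - a`. It is used for the filtration subspaces, so that weight components stay in
`𝒟^m`. -/
theorem mem_of_sum_eigenvectors_mem {p : Submodule ℂ V} (hp : ∀ x ∈ p, T x ∈ p) (s : Finset ℂ)
    (x : ℂ → V) (hx : ∀ c ∈ s, x c ∈ T.eigenspace c) (hs : ∑ c ∈ s, x c ∈ p) :
    ∀ c ∈ s, x c ∈ p := by
  classical
  induction s using Finset.induction_on generalizing x with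
  | empty => simp
  | insert a s ha ih =>
    have h1 : ∑ c ∈ s, (c - a) • x c ∈ p := by
      have h2 := p.sub_mem (hp _ hs) (p.smul_mem a hs)
      rw [map_sum, Finset.smul_sum, ← Finset.sum_sub_distrib, Finset.sum_insert ha] at h2
      have h3 : ∀ c ∈ insert a s, T (x c) - a • x c = (c - a) • x c := fun c hc => by
        rw [Module.End.mem_eigenspace_iff.1 (hx c hc), sub_smul]
      rw [h3 a (Finset.mem_insert_self _ _), sub_self, zero_smul, zero_add,
        Finset.sum_congr rfl fun c hc => h3 c (Finset.mem_insert_of_mem hc)] at h2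
      exact h2
    have h4 := ih (fun c => (c - a) • x c)
      (fun c hc => Submodule.smul_mem _ _ (hx c (Finset.mem_insert_of_mem hc))) h1
    have h5 : ∀ c ∈ s, x c ∈ p := fun c hc =>
      (p.smul_mem_iff (sub_ne_zero.2 fun h => ha (by rwa [← h]))).1 (h4 c hc)
    intro c hc
    rcases Finset.mem_insert.1 hc with rfl | hc
    · rw [Finset.sum_insert ha] at hs
      exact (p.add_mem_iff_left (p.sum_mem h5)).1 hs
    · exact h5 c hc

/-- To prove a property of the elements of an invariant subspace that is closed under sums, it
suffices to prove it for eigenvectors in the subspace. -/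
theorem IsDiagonalizable.induction_on (h : IsDiagonalizable T) {p : Submodule ℂ V}
    (hp : ∀ x ∈ p, T x ∈ p) {P : V → Prop} (h0 : P 0) (hadd : ∀ x y, P x → P y → P (x + y))
    (heig : ∀ c, T.HasEigenvalue c → ∀ x ∈ p, x ∈ T.eigenspace c → P x) {x : V} (hx : x ∈ p) :
    P x := by
  classical
  obtain ⟨y, rfl⟩ := h.2 x
  have hxy : DirectSum.coeAddMonoidHom (fun c : ℂ => T.eigenspace c) y =
      ∑ c ∈ y.support, (y c : V) := by
    rw [DirectSum.coeAddMonoidHom_eq_dfinsuppSum]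
    rfl
  rw [hxy] at hx ⊢
  have hmem := mem_of_sum_eigenvectors_mem hp y.support (fun c => (y c : V))
    (fun c _ => (y c).2) hx
  refine Finset.sum_induction _ P hadd h0 fun c hc => heig c ?_ _ (hmem c hc) (y c).2
  exact Module.End.hasEigenvalue_of_hasEigenvector
    ⟨(y c).2, fun h => DFinsupp.mem_support_iff.1 hc (Subtype.ext h)⟩

theorem pow_apply_of_mem_eigenspace {c : ℂ} {x : V} (hx : x ∈ T.eigenspace c) (r : ℕ) :
    (T ^ r) x = c ^ r • x := by
  rw [Module.End.mem_eigenspace_iff] at hx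
  induction r with
  | zero => simp
  | succ k ih => rw [pow_succ, Module.End.mul_apply, hx, map_smul, ih, smul_smul, pow_succ']

theorem HasPositiveEigenvalues.pow (h : IsDiagonalizable T) (hpos : HasPositiveEigenvalues T)
    (r : ℕ) : HasPositiveEigenvalues (T ^ r) := by
  intro c hc
  by_contra hne
  obtain ⟨x, hx, hx0⟩ := hc.exists_hasEigenvector
  refine hx0 ?_
  -- If `c` is not a positive real, it differs from `d ^ r` for every eigenvalue `d`, so `J` is a
  -- left inverse of `T ^ r - c` and the eigenvector `x` must vanish.
  let J : V →ₗ[ℂ] V := eigenLift h fun d => (d ^ r - c)⁻¹ • LinearMap.id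
  have hJ : ∀ y : V, J ((T ^ r) y - c • y) = y := by
    intro y
    refine h.induction_on (p := ⊤) (fun _ _ => trivial) (P := fun y => J ((T ^ r) y - c • y) = y)
      (by simp) ?_ ?_ (x := y) trivial
    · intro y z hy hz
      conv_rhs => rw [← hy, ← hz]
      rw [← map_add]
      congr 1
      rw [map_add, smul_add]
      abel
    · intro d hd y _ hy
      obtain ⟨e, he, rfl⟩ := hpos d hd
      rw [pow_apply_of_mem_eigenspace hy, ← sub_smul, map_smul, eigenLift_apply h _ hy,
        LinearMap.smul_apply, LinearMap.id_apply, smul_smul, mul_inv_cancel₀, one_smul]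
      exact fun h0 => hne ⟨e ^ r, pow_pos he r, by rw [← sub_eq_zero.1 h0]; push_cast; rfl⟩
  have := hJ x
  rwa [Module.End.mem_eigenspace_iff.1 hx, sub_self, map_zero, eq_comm] at this

theorem finite_eigenProj_ne_zero (h : IsDiagonalizable T) (x : V) :
    {c | eigenProj T h c x ≠ 0}.Finite := by
  refine h.induction_on (p := ⊤) (fun _ _ => trivial)
    (P := fun x => {c | eigenProj T h c x ≠ 0}.Finite) (by simp) ?_ ?_ (x := x) trivial
  · intro y z hy hz
    refine (hy.union hz).subset fun c hc => ?_
    by_contra hn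
    simp only [Set.mem_union, Set.mem_ofPred_eq, not_or, not_not] at hn
    exact hc (by rw [map_add, hn.1, hn.2, add_zero])
  · intro c _ y _ hy
    refine (Set.finite_singleton c).subset fun d hd => ?_
    by_contra hn
    exact hd (eigenProj_of_mem_of_ne h hy hn)

/-- Exhibits the `finsum` as a linear map, so that identities about it can be checked on
eigenvectors. -/
theorem diagCPow_eq_eigenLift (h : IsDiagonalizable T) (z : ℂ) (x : V) :
    diagCPow T h z x = eigenLift h (fun c => c ^ z • LinearMap.id) x := by
  refine h.induction_on (p := ⊤) (fun _ _ => trivial)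
    (P := fun x => diagCPow T h z x = eigenLift h (fun c => c ^ z • LinearMap.id) x) ?_ ?_ ?_
    (x := x) trivial
  · simp [diagCPow]
  · intro y w hy hw
    have hfin : ∀ y, (Function.support fun c : ℂ => c ^ z • eigenProj T h c y).Finite := fun y =>
      (finite_eigenProj_ne_zero h y).subset fun c hc h0 => hc (by dsimp only; rw [h0, smul_zero])
    rw [map_add, ← hy, ← hw]
    unfold diagCPow
    rw [← finsum_add_distrib (hfin y) (hfin w)]
    simp only [map_add, smul_add]
  · intro c _ y _ hy
    rw [eigenLift_apply h _ hy]
    unfold diagCPow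
    rw [finsum_eq_single _ c fun d hd => by rw [eigenProj_of_mem_of_ne h hy hd, smul_zero],
      eigenProj_of_mem h hy]
    rfl

end Diagonalizable

/-! ### Divided differences on the right half plane -/

/-- The open right half plane. -/
def rightHalfPlane : Set ℂ := {s | 0 < s.re}

theorem isOpen_rightHalfPlane : IsOpen rightHalfPlane :=
  isOpen_lt continuous_const Complex.continuous_re

theorem ofReal_mem_rightHalfPlane {x : ℝ} (hx : 0 < x) : (x : ℂ) ∈ rightHalfPlane := by
  simpa [rightHalfPlane] using hx

theorem differentiableOn_cpow_rightHalfPlane (z : ℂ) :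
    DifferentiableOn ℂ (fun s : ℂ => s ^ z) rightHalfPlane := fun _ hs =>
  (differentiableAt_id.cpow_const (Or.inl hs)).differentiableWithinAt

theorem differentiableOn_dslope_rightHalfPlane {f : ℂ → ℂ}
    (hf : DifferentiableOn ℂ f rightHalfPlane)
    {a : ℂ} (ha : a ∈ rightHalfPlane) : DifferentiableOn ℂ (dslope f a) rightHalfPlane :=
  (Complex.differentiableOn_dslope (isOpen_rightHalfPlane.mem_nhds ha)).2 hf

theorem dslope_congr {f g : ℂ → ℂ} {U : Set ℂ} (hU : IsOpen U) (h : Set.EqOn f g U) {a : ℂ}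
    (ha : a ∈ U) : Set.EqOn (dslope f a) (dslope g a) U := by
  intro b hb
  rcases eq_or_ne b a with rfl | hne
  · rw [dslope_same, dslope_same]
    exact (h.eventuallyEq_of_mem (hU.mem_nhds hb)).deriv_eq
  · rw [dslope_of_ne _ hne, dslope_of_ne _ hne, slope_def_field, slope_def_field, h ha, h hb]

theorem dslope_add {f g : ℂ → ℂ} {a : ℂ} (hf : DifferentiableAt ℂ f a)
    (hg : DifferentiableAt ℂ g a) : dslope (f + g) a = dslope f a + dslope g a := by
  ext b
  rcases eq_or_ne b a with rfl | hne
  · simp only [dslope_same, Pi.add_apply, deriv_add hf hg]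
  · simp only [dslope_of_ne _ hne, Pi.add_apply, slope_def_field]
    ring

theorem dslope_const_smul (c : ℂ) (f : ℂ → ℂ) (a : ℂ) : dslope (c • f) a = c • dslope f a := by
  ext b
  rcases eq_or_ne b a with rfl | hne
  · simp only [dslope_same, Pi.smul_apply, deriv_const_smul_field]
  · simp only [dslope_of_ne _ hne, Pi.smul_apply, slope_def_field, smul_eq_mul]
    ring

theorem dslope_mul {f g : ℂ → ℂ} {a : ℂ} (hf : DifferentiableAt ℂ f a)
    (hg : DifferentiableAt ℂ g a) : dslope (f * g) a = dslope f a * g + f a • dslope g a := by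
  ext b
  rcases eq_or_ne b a with rfl | hne
  · simp only [dslope_same, Pi.add_apply, Pi.mul_apply, Pi.smul_apply, deriv_mul hf hg, smul_eq_mul]
  · simp only [dslope_of_ne _ hne, Pi.add_apply, Pi.mul_apply, Pi.smul_apply, slope_def_field,
      smul_eq_mul]
    ring

theorem dslope_id (a : ℂ) : dslope (fun s : ℂ => s) a = fun _ => 1 := by
  ext b
  rcases eq_or_ne b a with rfl | hne
  · simp
  · rw [dslope_of_ne _ hne, slope_def_field, div_self (sub_ne_zero.2 hne)]

theorem dslope_const (c a : ℂ) : dslope (fun _ : ℂ => c) a = 0 := by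
  ext b
  rcases eq_or_ne b a with rfl | hne
  · simp
  · rw [dslope_of_ne _ hne, slope_def_field]
    simp

/-! ### The coefficients of the expansion -/

namespace TwistedDOAlgebra

variable {H : Type*} [NormedAddCommGroup H] [InnerProductSpace ℂ H] [CompleteSpace H]
variable {Δ : AbstractLaplace H} {r : ℕ} (𝒟 : TwistedDOAlgebra Δ r)

theorem toEnd_injective : Function.Injective 𝒟.toEnd := 𝒟.carrier.injective_subtype

/-- The twisted commutator with `Δ` as a linear map. -/
def nablaLin : 𝒟.Alg →ₗ[ℂ] 𝒟.Alg where
  toFun := 𝒟.nabla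
  map_add' X Y := 𝒟.toEnd_injective <| by
    change Δ.op * 𝒟.toEnd (X + Y) - 𝒟.toEnd ((𝒟.θ ^ r) (X + Y)) * Δ.op =
      (Δ.op * 𝒟.toEnd X - 𝒟.toEnd ((𝒟.θ ^ r) X) * Δ.op) +
        (Δ.op * 𝒟.toEnd Y - 𝒟.toEnd ((𝒟.θ ^ r) Y) * Δ.op)
    simp only [map_add, mul_add, add_mul]
    abel
  map_smul' a X := 𝒟.toEnd_injective <| by
    change Δ.op * 𝒟.toEnd (a • X) - 𝒟.toEnd ((𝒟.θ ^ r) (a • X)) * Δ.op =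
      a • (Δ.op * 𝒟.toEnd X - 𝒟.toEnd ((𝒟.θ ^ r) X) * Δ.op)
    simp only [map_smul, mul_smul_comm, smul_mul_assoc, smul_sub]

@[simp]
theorem nablaLin_apply (X : 𝒟.Alg) : 𝒟.nablaLin X = 𝒟.nabla X := rfl

theorem toEnd_nabla (X : 𝒟.Alg) :
    𝒟.toEnd (𝒟.nabla X) = Δ.op * 𝒟.toEnd X - 𝒟.toEnd ((𝒟.θ ^ r) X) * Δ.op := rfl

theorem nabla_mem {m : ℕ} {X : 𝒟.Alg} (hX : 𝒟.toEnd X ∈ 𝒟.filt m) :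
    𝒟.toEnd (𝒟.nabla X) ∈ 𝒟.filt (m + (r - 1)) := 𝒟.commutator_mem m X hX

theorem θ_pow_mem {m : ℕ} (k : ℕ) {X : 𝒟.Alg} (hX : 𝒟.toEnd X ∈ 𝒟.filt m) :
    𝒟.toEnd ((𝒟.θ ^ k) X) ∈ 𝒟.filt m := by
  induction k with
  | zero => exact hX
  | succ k ih =>
    rw [pow_succ', Module.End.mul_apply]
    exact 𝒟.twist_mem m _ ih

theorem exists_mem_filt (X : 𝒟.Alg) : ∃ m, 𝒟.toEnd X ∈ 𝒟.filt m := (𝒟.mem_carrier_iff _).1 X.2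

variable {𝒟}

/-- Reduction of additive properties of elements of `𝒟^m` to those of pure weight. -/
theorem weight_induction (hdiag : IsDiagonalizable 𝒟.θ) (hpos : HasPositiveEigenvalues 𝒟.θ)
    {m : ℕ} {P : 𝒟.Alg → Prop} (h0 : P 0) (hadd : ∀ X Y, P X → P Y → P (X + Y))
    (hw : ∀ μ : ℝ, 0 < μ → μ ∈ 𝒟.weights → ∀ X, 𝒟.toEnd X ∈ 𝒟.filt m →
      X ∈ (𝒟.θ ^ r).eigenspace (μ : ℂ) → P X) {X : 𝒟.Alg} (hX : 𝒟.toEnd X ∈ 𝒟.filt m) : P X := by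
  refine (hdiag.pow r).induction_on (p := (𝒟.filt m).comap 𝒟.toEnd)
    (fun X hX => 𝒟.θ_pow_mem r hX) h0 hadd ?_ hX
  intro c hc X hX hXc
  obtain ⟨μ, hμ, rfl⟩ := hpos.pow hdiag r c hc
  exact hw μ hμ hc X hX hXc

theorem linearMap_ext_weight (hdiag : IsDiagonalizable 𝒟.θ) (hpos : HasPositiveEigenvalues 𝒟.θ)
    {W : Type*} [AddCommGroup W] [Module ℂ W] {L M : 𝒟.Alg →ₗ[ℂ] W}
    (h : ∀ μ : ℝ, 0 < μ → ∀ X ∈ (𝒟.θ ^ r).eigenspace (μ : ℂ), L X = M X) : L = M := by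
  ext X
  obtain ⟨m, hm⟩ := 𝒟.exists_mem_filt X
  refine weight_induction hdiag hpos (P := fun X => L X = M X) (by simp) ?_ ?_ hm
  · intro X Y hX hY
    rw [map_add, map_add, hX, hY]
  · intro μ hμ _ X _ hX
    exact h μ hμ X hX

variable (𝒟)

/-- The sum over all `(k + 1)`-tuples of weights of the divided difference of `f` times the
iterated twisted commutator, as a linear map on `𝒟`. -/
def coeffMap (hdiag : IsDiagonalizable 𝒟.θ) : ℕ → (ℂ → ℂ) → 𝒟.Alg →ₗ[ℂ] 𝒟.Alg
  | 0, f => eigenLift (hdiag.pow r) fun c => f c • LinearMap.id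
  | k + 1, f => eigenLift (hdiag.pow r) fun c => coeffMap hdiag k (dslope f c) ∘ₗ 𝒟.nablaLin

variable {𝒟} (hdiag : IsDiagonalizable 𝒟.θ)

theorem coeffMap_zero_apply (f : ℂ → ℂ) {c : ℂ} {X : 𝒟.Alg} (hX : X ∈ (𝒟.θ ^ r).eigenspace c) :
    𝒟.coeffMap hdiag 0 f X = f c • X := by
  rw [coeffMap, eigenLift_apply _ _ hX]
  rfl

theorem coeffMap_succ_apply (k : ℕ) (f : ℂ → ℂ) {c : ℂ} {X : 𝒟.Alg}
    (hX : X ∈ (𝒟.θ ^ r).eigenspace c) :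
    𝒟.coeffMap hdiag (k + 1) f X = 𝒟.coeffMap hdiag k (dslope f c) (𝒟.nabla X) := by
  rw [coeffMap, eigenLift_apply _ _ hX]
  rfl

variable (hpos : HasPositiveEigenvalues 𝒟.θ)

include hpos in
-- Each twisted commutator costs `r - 1` orders, and splitting into weights costs nothing because
-- `θ` preserves the filtration.
theorem coeffMap_mem (k : ℕ) (f : ℂ → ℂ) {m : ℕ} {X : 𝒟.Alg} (hX : 𝒟.toEnd X ∈ 𝒟.filt m) :
    𝒟.toEnd (𝒟.coeffMap hdiag k f X) ∈ 𝒟.filt (m + k * (r - 1)) := by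
  induction k generalizing f m X with
  | zero =>
    refine weight_induction hdiag hpos
      (P := fun X => 𝒟.toEnd (𝒟.coeffMap hdiag 0 f X) ∈ 𝒟.filt (m + 0 * (r - 1))) ?_ ?_ ?_ hX
    · rw [map_zero, map_zero]; exact Submodule.zero_mem _
    · intro X Y hX hY
      rw [map_add, map_add]
      exact Submodule.add_mem _ hX hY
    · intro μ _ _ X hX hXμ
      rw [coeffMap_zero_apply hdiag f hXμ, map_smul, zero_mul, add_zero]
      exact Submodule.smul_mem _ _ hX
  | succ k ih =>
    refine weight_induction hdiag hpos
      (P := fun X => 𝒟.toEnd (𝒟.coeffMap hdiag (k + 1) f X) ∈ 𝒟.filt (m + (k + 1) * (r - 1)))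
      ?_ ?_ ?_ hX
    · rw [map_zero, map_zero]; exact Submodule.zero_mem _
    · intro X Y hX hY
      rw [map_add, map_add]
      exact Submodule.add_mem _ hX hY
    · intro μ _ _ X hX hXμ
      rw [coeffMap_succ_apply hdiag k f hXμ]
      have := ih (dslope f μ) (𝒟.nabla_mem hX)
      rwa [add_assoc, add_comm (r - 1), ← Nat.succ_mul] at this

include hpos in
-- All weights lie in the right half plane. Its openness makes derivatives at repeated weights agree
-- too.
theorem coeffMap_congr (k : ℕ) {f g : ℂ → ℂ} (h : Set.EqOn f g rightHalfPlane) :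
    𝒟.coeffMap hdiag k f = 𝒟.coeffMap hdiag k g := by
  induction k generalizing f g with
  | zero =>
    refine linearMap_ext_weight hdiag hpos fun μ hμ X hX => ?_
    rw [coeffMap_zero_apply _ _ hX, coeffMap_zero_apply _ _ hX, h (ofReal_mem_rightHalfPlane hμ)]
  | succ k ih =>
    refine linearMap_ext_weight hdiag hpos fun μ hμ X hX => ?_
    rw [coeffMap_succ_apply _ _ _ hX, coeffMap_succ_apply _ _ _ hX,
      ih (dslope_congr isOpen_rightHalfPlane h (ofReal_mem_rightHalfPlane hμ))]

include hpos in
theorem coeffMap_add (k : ℕ) {f g : ℂ → ℂ} (hf : DifferentiableOn ℂ f rightHalfPlane)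
    (hg : DifferentiableOn ℂ g rightHalfPlane) :
    𝒟.coeffMap hdiag k (f + g) = 𝒟.coeffMap hdiag k f + 𝒟.coeffMap hdiag k g := by
  induction k generalizing f g with
  | zero =>
    refine linearMap_ext_weight hdiag hpos fun μ hμ X hX => ?_
    rw [LinearMap.add_apply, coeffMap_zero_apply _ _ hX, coeffMap_zero_apply _ _ hX,
      coeffMap_zero_apply _ _ hX, Pi.add_apply, add_smul]
  | succ k ih =>
    refine linearMap_ext_weight hdiag hpos fun μ hμ X hX => ?_
    have hU := isOpen_rightHalfPlane.mem_nhds (ofReal_mem_rightHalfPlane hμ)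
    rw [LinearMap.add_apply, coeffMap_succ_apply _ _ _ hX, coeffMap_succ_apply _ _ _ hX,
      coeffMap_succ_apply _ _ _ hX, dslope_add (hf.differentiableAt hU) (hg.differentiableAt hU),
      ih (differentiableOn_dslope_rightHalfPlane hf (ofReal_mem_rightHalfPlane hμ))
        (differentiableOn_dslope_rightHalfPlane hg (ofReal_mem_rightHalfPlane hμ)),
      LinearMap.add_apply]

include hpos in
theorem coeffMap_smul (k : ℕ) (c : ℂ) (f : ℂ → ℂ) :
    𝒟.coeffMap hdiag k (c • f) = c • 𝒟.coeffMap hdiag k f := by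
  induction k generalizing f with
  | zero =>
    refine linearMap_ext_weight hdiag hpos fun μ hμ X hX => ?_
    rw [LinearMap.smul_apply, coeffMap_zero_apply _ _ hX, coeffMap_zero_apply _ _ hX,
      Pi.smul_apply, smul_assoc]
  | succ k ih =>
    refine linearMap_ext_weight hdiag hpos fun μ hμ X hX => ?_
    rw [LinearMap.smul_apply, coeffMap_succ_apply _ _ _ hX, coeffMap_succ_apply _ _ _ hX,
      dslope_const_smul, ih, LinearMap.smul_apply]

include hpos in
/-- The Leibniz rule for divided differences. -/
theorem coeffMap_mul (n : ℕ) {f g : ℂ → ℂ} (hf : DifferentiableOn ℂ f rightHalfPlane)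
    (hg : DifferentiableOn ℂ g rightHalfPlane) :
    𝒟.coeffMap hdiag n (f * g) =
      ∑ i ∈ Finset.range (n + 1), 𝒟.coeffMap hdiag (n - i) g ∘ₗ 𝒟.coeffMap hdiag i f := by
  induction n generalizing f with
  | zero =>
    refine linearMap_ext_weight hdiag hpos fun μ hμ X hX => ?_
    rw [Finset.sum_range_one, LinearMap.comp_apply, coeffMap_zero_apply _ _ hX,
      coeffMap_zero_apply _ _ hX, map_smul, coeffMap_zero_apply _ _ hX, smul_smul, Pi.mul_apply]
  | succ n ih =>
    refine linearMap_ext_weight hdiag hpos fun μ hμ X hX => ?_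
    have hμU := ofReal_mem_rightHalfPlane hμ
    have hU := isOpen_rightHalfPlane.mem_nhds hμU
    have hdf := differentiableOn_dslope_rightHalfPlane hf hμU
    rw [coeffMap_succ_apply _ _ _ hX, dslope_mul (hf.differentiableAt hU) (hg.differentiableAt hU),
      coeffMap_add hdiag hpos _ (hdf.mul hg)
        ((differentiableOn_dslope_rightHalfPlane hg hμU).const_smul _),
      coeffMap_smul hdiag hpos, ih hdf, Finset.sum_range_succ' _ (n + 1)]
    simp only [LinearMap.add_apply, LinearMap.sum_apply, LinearMap.comp_apply, LinearMap.smul_apply]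
    -- The terms with `i ≥ 1` come from `dslope f μ * g`, and the term `i = 0` from `f μ • dslope g
    -- μ`.
    refine congrArg₂ (· + ·) (Finset.sum_congr rfl fun i _ => ?_) ?_
    · rw [coeffMap_succ_apply _ _ _ hX, Nat.add_sub_add_right]
    · rw [coeffMap_zero_apply _ _ hX, map_smul, Nat.sub_zero, coeffMap_succ_apply _ _ _ hX]

include hpos in
theorem coeffMap_zero_fun (k : ℕ) : 𝒟.coeffMap hdiag k 0 = 0 := by
  have := coeffMap_smul hdiag hpos k 0 0
  rwa [zero_smul, zero_smul] at this

include hpos in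
theorem coeffMap_id_zero : 𝒟.coeffMap hdiag 0 (fun s => s) = 𝒟.θ ^ r := by
  refine linearMap_ext_weight hdiag hpos fun μ hμ X hX => ?_
  rw [coeffMap_zero_apply _ _ hX, Module.End.mem_eigenspace_iff.1 hX]

include hpos in
theorem coeffMap_const_zero (c : ℂ) : 𝒟.coeffMap hdiag 0 (fun _ => c) = c • LinearMap.id := by
  refine linearMap_ext_weight hdiag hpos fun μ hμ X hX => ?_
  rw [coeffMap_zero_apply _ _ hX]
  rfl

include hpos in
theorem coeffMap_id_one : 𝒟.coeffMap hdiag 1 (fun s => s) = 𝒟.nablaLin := by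
  refine linearMap_ext_weight hdiag hpos fun μ hμ X hX => ?_
  rw [coeffMap_succ_apply _ _ _ hX, dslope_id, coeffMap_const_zero hdiag hpos]
  simp

include hpos in
-- The divided differences of `s` are `s`, then `1`, then `0`, so the expansion for `z = 1` stops
-- after two terms.
theorem coeffMap_id_add_two (k : ℕ) : 𝒟.coeffMap hdiag (k + 2) (fun s => s) = 0 := by
  refine linearMap_ext_weight hdiag hpos fun μ hμ X hX => ?_
  rw [coeffMap_succ_apply _ _ _ hX, dslope_id]
  have : 𝒟.coeffMap hdiag (k + 1) (fun _ => (1 : ℂ)) = 0 := by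
    refine linearMap_ext_weight (W := 𝒟.Alg) hdiag hpos fun μ hμ X hX => ?_
    rw [coeffMap_succ_apply _ _ _ hX, dslope_const, coeffMap_zero_fun hdiag hpos]
    rfl
  rw [this]
  rfl

end TwistedDOAlgebra

/-! ### Generalized binomial coefficients as divided differences -/

section DividedDifferences

open Polynomial

/-- Divided differences. -/
def divDiff : (k : ℕ) → (ℂ → ℂ) → (Fin (k + 1) → ℂ) → ℂ
  | 0, f, μ => f (μ 0)
  | k + 1, f, μ => divDiff k (dslope f (μ 0)) (Fin.tail μ)

/-- Newton's interpolation formula. -/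
theorem exists_newton_interpolant (k : ℕ) {f : ℂ → ℂ} (hf : DifferentiableOn ℂ f rightHalfPlane)
    (μ : Fin (k + 1) → ℂ) (hμ : ∀ i, μ i ∈ rightHalfPlane) :
    ∃ p : ℂ[X], p.natDegree ≤ k ∧ p.coeff k = divDiff k f μ ∧
      ∃ G : ℂ → ℂ, DifferentiableOn ℂ G rightHalfPlane ∧
        ∀ s ∈ rightHalfPlane, f s = p.eval s + (∏ i, (s - μ i)) * G s := by
  induction k generalizing f with
  | zero =>
    refine ⟨C (f (μ 0)), by simp, by simp [divDiff], dslope f (μ 0),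
      differentiableOn_dslope_rightHalfPlane hf (hμ 0), fun s _ => ?_⟩
    have := sub_smul_dslope f (μ 0) s
    rw [smul_eq_mul] at this
    simp [this]
  | succ k ih =>
    obtain ⟨q, hq, hqk, G, hG, hqG⟩ := ih (differentiableOn_dslope_rightHalfPlane hf (hμ 0))
      (Fin.tail μ) fun i => hμ i.succ
    refine ⟨C (f (μ 0)) + (X - C (μ 0)) * q, ?_, ?_, G, hG, fun s hs => ?_⟩
    · refine (natDegree_add_le _ _).trans (max_le (by simp) (natDegree_mul_le.trans ?_))
      rw [natDegree_X_sub_C]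
      omega
    · rw [coeff_add, coeff_C_succ, zero_add, coeff_X_sub_C_mul, hqk,
        coeff_eq_zero_of_natDegree_lt (Nat.lt_succ_of_le hq)]
      simp [divDiff]
    · have := sub_smul_dslope f (μ 0) s
      rw [smul_eq_mul, hqG s hs] at this
      rw [Fin.prod_univ_succ, eval_add, eval_mul, eval_C, eval_sub, eval_X, eval_C]
      simp only [Fin.tail] at this
      linear_combination -this

theorem iteratedDeriv_eval_polynomial (p : ℂ[X]) (k : ℕ) :
    iteratedDeriv k (fun s => p.eval s) = fun s => (derivative^[k] p).eval s := by
  induction k with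
  | zero => simp
  | succ k ih =>
    rw [iteratedDeriv_succ, ih]
    ext s
    rw [Polynomial.deriv, Function.iterate_succ_apply']

/-- By Newton's formula `s ^ z - p(s)` is `∏ (s - μⱼ)` times a holomorphic function, so it vanishes
at each node to at least its multiplicity. Hence `p` is the Hermite interpolant, and its top
coefficient is the divided difference. -/
theorem muBinom_eq_divDiff (z : ℂ) (k : ℕ) (μ : Fin (k + 1) → ℝ) (hμ : ∀ i, 0 < μ i) :
    muBinom z k μ = divDiff k (fun s => s ^ z) (fun i => (μ i : ℂ)) := by
  classical
  obtain ⟨p, hp, hpk, G, hG, hpG⟩ := exists_newton_interpolant k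
    (differentiableOn_cpow_rightHalfPlane z) (fun i => (μ i : ℂ))
    (fun i => ofReal_mem_rightHalfPlane (hμ i))
  have hinterp : IsHermiteInterpolant (fun s : ℂ => s ^ z) (fun i => (μ i : ℂ)) p := by
    refine ⟨hp, fun i j hj => ?_⟩
    have hiU := isOpen_rightHalfPlane.mem_nhds (ofReal_mem_rightHalfPlane (hμ i))
    have hf : AnalyticAt ℂ (fun s : ℂ => s ^ z) (μ i) :=
      (differentiableOn_cpow_rightHalfPlane z).analyticAt hiU
    have hpa : AnalyticAt ℂ (fun s : ℂ => p.eval s) (μ i) :=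
      (Polynomial.differentiable p).analyticAt _
    let n := multiplicityIn (fun i => (μ i : ℂ)) i
    have hord : (n : ℕ∞) ≤ analyticOrderAt ((fun s : ℂ => s ^ z) - fun s => p.eval s) (μ i) := by
      rw [natCast_le_analyticOrderAt (hf.sub hpa)]
      -- The factors at nodes equal to `μ i` form the required power; the remaining factors go into
      -- the analytic cofactor.
      refine ⟨fun s => (∏ j ∈ Finset.univ.filter fun j => ¬ (μ j : ℂ) = μ i, (s - μ j)) * G s,
        ?_, ?_⟩
      · refine AnalyticAt.mul ?_ (hG.analyticAt hiU)
        exact Finset.analyticAt_fun_prod _ fun j _ => analyticAt_id.sub analyticAt_const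
      · filter_upwards [hiU] with s hs
        rw [Pi.sub_apply, hpG s hs, add_sub_cancel_left, smul_eq_mul, ← mul_assoc]
        congr 1
        rw [← Finset.prod_filter_mul_prod_filter_not Finset.univ (fun j => (μ j : ℂ) = μ i)]
        congr 1
        exact (Finset.prod_congr rfl fun j hj => by
          rw [(Finset.mem_filter.1 hj).2]).trans (Finset.prod_const _)
    have h0 := (natCast_le_analyticOrderAt_iff_iteratedDeriv_eq_zero (hf.sub hpa)).1 hord j hj
    rw [iteratedDeriv_sub (hf.contDiffAt.of_le le_top) (hpa.contDiffAt.of_le le_top),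
      iteratedDeriv_eval_polynomial] at h0
    exact (sub_eq_zero.1 h0).symm
  have : hermiteInterpolant (fun s : ℂ => s ^ z) (fun i => (μ i : ℂ)) = p :=
    (exists_isHermiteInterpolant _ _).choose_spec.unique hinterp
  rw [muBinom, this, hpk]

end DividedDifferences

/-! ### The terms of the expansion -/

namespace TwistedDOAlgebra

variable {H : Type*} [NormedAddCommGroup H] [InnerProductSpace ℂ H] [CompleteSpace H]
variable {Δ : AbstractLaplace H} {r : ℕ} {𝒟 : TwistedDOAlgebra Δ r} (hdiag : IsDiagonalizable 𝒟.θ)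

theorem weightComponent_add (μ : ℝ) (X Y : 𝒟.Alg) :
    𝒟.weightComponent hdiag μ (X + Y) =
      𝒟.weightComponent hdiag μ X + 𝒟.weightComponent hdiag μ Y := map_add _ _ _

theorem weightComponent_zero (μ : ℝ) : 𝒟.weightComponent hdiag μ 0 = 0 := map_zero _

theorem weightComponent_self {μ : ℝ} {X : 𝒟.Alg} (hX : X ∈ (𝒟.θ ^ r).eigenspace (μ : ℂ)) :
    𝒟.weightComponent hdiag μ X = X := eigenProj_of_mem _ hX

theorem weightComponent_of_ne {μ ν : ℝ} {X : 𝒟.Alg} (hX : X ∈ (𝒟.θ ^ r).eigenspace (μ : ℂ))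
    (h : ν ≠ μ) : 𝒟.weightComponent hdiag ν X = 0 :=
  eigenProj_of_mem_of_ne _ hX fun h' => h (Complex.ofReal_injective h')

theorem finite_weightComponent_ne_zero (X : 𝒟.Alg) :
    {w : 𝒟.weights | 𝒟.weightComponent hdiag w X ≠ 0}.Finite :=
  (finite_eigenProj_ne_zero (hdiag.pow r) X).preimage
    (f := fun w : 𝒟.weights => ((w : ℝ) : ℂ))
    fun _ _ _ _ h => Subtype.ext (Complex.ofReal_injective h)

theorem nabla_zero : 𝒟.nabla 0 = 0 := 𝒟.nablaLin.map_zero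

theorem nablaMulti_zero_right (k : ℕ) (μ : Fin (k + 1) → ℝ) : 𝒟.nablaMulti hdiag k μ 0 = 0 := by
  induction k with
  | zero => exact weightComponent_zero hdiag _
  | succ k ih => rw [nablaMulti, ih, nabla_zero, weightComponent_zero]

theorem nablaMulti_add (k : ℕ) (μ : Fin (k + 1) → ℝ) (X Y : 𝒟.Alg) :
    𝒟.nablaMulti hdiag k μ (X + Y) = 𝒟.nablaMulti hdiag k μ X + 𝒟.nablaMulti hdiag k μ Y := by
  induction k with
  | zero => exact weightComponent_add hdiag _ _ _
  | succ k ih =>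
    rw [nablaMulti, ih, ← nablaLin_apply, map_add, weightComponent_add]
    rfl

/-- `nablaMulti` recurses on the last weight, while `divDiff` and `coeffMap` recurse on the first;
this reconciles them. -/
theorem nablaMulti_succ_left (k : ℕ) (μ : Fin (k + 2) → ℝ) (Y : 𝒟.Alg) :
    𝒟.nablaMulti hdiag (k + 1) μ Y =
      𝒟.nablaMulti hdiag k (Fin.tail μ) (𝒟.nabla (𝒟.weightComponent hdiag (μ 0) Y)) := by
  induction k with
  | zero => rfl
  | succ k ih =>
    rw [nablaMulti, ih (Fin.init μ)]
    conv_rhs => rw [nablaMulti]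
    rfl

theorem finite_nablaMulti_ne_zero (k : ℕ) (Y : 𝒟.Alg) :
    {μ : Fin (k + 1) → 𝒟.weights | 𝒟.nablaMulti hdiag k (fun i => (μ i : ℝ)) Y ≠ 0}.Finite := by
  induction k generalizing Y with
  | zero =>
    exact (finite_weightComponent_ne_zero hdiag Y).preimage
      (f := fun μ : Fin 1 → 𝒟.weights => μ 0) fun μ _ ν _ h => funext fun i => by
        rw [Subsingleton.elim i 0]; exact h
  | succ k ih =>
    refine ((finite_weightComponent_ne_zero hdiag Y).biUnion fun w _ =>
      (ih (𝒟.nabla (𝒟.weightComponent hdiag w Y))).image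
        fun μ => (Fin.cons w μ : Fin (k + 2) → 𝒟.weights)).subset ?_
    intro μ hμ
    have hμ' : 𝒟.nablaMulti hdiag k (fun i => (Fin.tail μ i : ℝ))
        (𝒟.nabla (𝒟.weightComponent hdiag (μ 0) Y)) ≠ 0 := by
      rw [Set.mem_ofPred_eq, nablaMulti_succ_left] at hμ
      exact hμ
    refine Set.mem_biUnion (x := μ 0) ?_ ⟨Fin.tail μ, hμ', Fin.cons_self_tail μ⟩
    intro h0
    rw [h0, nabla_zero, nablaMulti_zero_right] at hμ'
    exact hμ' rfl

theorem finite_support_smul_nablaMulti (k : ℕ) (c : (Fin (k + 1) → 𝒟.weights) → ℂ) (Y : 𝒟.Alg) :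
    (Function.support fun μ : Fin (k + 1) → 𝒟.weights =>
      c μ • 𝒟.nablaMulti hdiag k (fun i => (μ i : ℝ)) Y).Finite :=
  (finite_nablaMulti_ne_zero hdiag k Y).subset fun μ hμ h0 => hμ (by dsimp only; rw [h0, smul_zero])

/-- On a vector of weight `w` only tuples beginning with `w` contribute, and the sum over their
tails is the inductive case for `dslope f w` and `∇X`. -/
theorem finsum_divDiff_smul_nablaMulti (hpos : HasPositiveEigenvalues 𝒟.θ) (k : ℕ) (f : ℂ → ℂ)
    (Y : 𝒟.Alg) :
    ∑ᶠ μ : Fin (k + 1) → 𝒟.weights, divDiff k f (fun i => ((μ i : ℝ) : ℂ)) •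
      𝒟.nablaMulti hdiag k (fun i => (μ i : ℝ)) Y = 𝒟.coeffMap hdiag k f Y := by
  obtain ⟨m, hm⟩ := 𝒟.exists_mem_filt Y
  induction k generalizing f Y m with
  | zero =>
    refine weight_induction hdiag hpos (P := fun Y => ∑ᶠ μ : Fin (0 + 1) → 𝒟.weights,
      divDiff 0 f (fun i => ((μ i : ℝ) : ℂ)) •
        𝒟.nablaMulti hdiag 0 (fun i => (μ i : ℝ)) Y = 𝒟.coeffMap hdiag 0 f Y) ?_ ?_ ?_ hm
    · simp [nablaMulti_zero_right]
    · intro X Y hX hY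
      rw [map_add, ← hX, ← hY, ← finsum_add_distrib (finite_support_smul_nablaMulti hdiag _ _ X)
        (finite_support_smul_nablaMulti hdiag _ _ Y)]
      simp only [nablaMulti_add, smul_add]
    · intro w _ hwW X _ hX
      rw [coeffMap_zero_apply hdiag f hX, finsum_eq_single _ (fun _ => ⟨w, hwW⟩)]
      · simp only [nablaMulti, divDiff]
        rw [weightComponent_self hdiag hX]
      · intro μ hμ
        simp only [nablaMulti]
        rw [weightComponent_of_ne hdiag hX, smul_zero]
        intro h
        refine hμ (funext fun i => Subtype.ext ?_)
        rw [(Fin.subsingleton_one).elim i 0]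
        exact h
  | succ k ih =>
    refine weight_induction hdiag hpos (P := fun Y => ∑ᶠ μ : Fin (k + 1 + 1) → 𝒟.weights,
      divDiff (k + 1) f (fun i => ((μ i : ℝ) : ℂ)) •
        𝒟.nablaMulti hdiag (k + 1) (fun i => (μ i : ℝ)) Y = 𝒟.coeffMap hdiag (k + 1) f Y)
      ?_ ?_ ?_ hm
    · simp [nablaMulti_zero_right]
    · intro X Y hX hY
      rw [map_add, ← hX, ← hY, ← finsum_add_distrib (finite_support_smul_nablaMulti hdiag _ _ X)
        (finite_support_smul_nablaMulti hdiag _ _ Y)]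
      simp only [nablaMulti_add, smul_add]
    · intro w _ hwW X hXm hX
      rw [coeffMap_succ_apply hdiag k f hX, ← ih (dslope f w) (𝒟.nabla X) _ (𝒟.nabla_mem hXm)]
      let e : (Fin (k + 1) → 𝒟.weights) → (Fin (k + 2) → 𝒟.weights) :=
        fun μ => Fin.cons ⟨w, hwW⟩ μ
      have hinj : Function.Injective e := Fin.cons_right_injective (α := fun _ => 𝒟.weights) _
      -- The sum is restricted to the tuples with first entry `w` and reindexed by their tails.
      rw [← finsum_mem_univ, finsum_mem_inter_support_eq' _ Set.univ (Set.range e),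
        finsum_mem_range hinj]
      · refine finsum_congr fun μ => ?_
        rw [nablaMulti_succ_left]
        have h1 : 𝒟.weightComponent hdiag (e μ 0) X = X :=
          weightComponent_self hdiag hX
        rw [h1]
        rfl
      · intro μ hμ
        refine iff_of_true trivial ⟨Fin.tail μ, ?_⟩
        by_contra hne
        refine hμ ?_
        dsimp only
        rw [nablaMulti_succ_left, weightComponent_of_ne hdiag hX, nabla_zero,
          nablaMulti_zero_right, smul_zero]
        intro h0
        refine hne ?_
        conv_rhs => rw [← Fin.cons_self_tail μ]
        exact congrArg (fun w' => (Fin.cons w' (Fin.tail μ) : Fin (k + 2) → 𝒟.weights))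
          (Subtype.ext h0.symm)

include hdiag in
theorem weights_pos (hpos : HasPositiveEigenvalues 𝒟.θ) (w : 𝒟.weights) : 0 < (w : ℝ) := by
  obtain ⟨x, hx, h⟩ := hpos.pow hdiag r _ w.2
  rwa [Complex.ofReal_injective h]

theorem expansionTerm_eq (hpos : HasPositiveEigenvalues 𝒟.θ) (z : ℂ) (Y : 𝒟.Alg) (k : ℕ) :
    𝒟.expansionTerm hdiag z Y k =
      𝒟.toEnd (𝒟.coeffMap hdiag k (fun s => s ^ z) Y) * Δ.cpow (z - k) := by
  rw [expansionTerm, ← finsum_divDiff_smul_nablaMulti hdiag hpos]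
  let L : 𝒟.Alg →ₗ[ℂ] Module.End ℂ Δ.smooth := LinearMap.mulRight ℂ (Δ.cpow (z - k)) ∘ₗ 𝒟.toEnd
  change _ = L.toAddMonoidHom _
  rw [AddMonoidHom.map_finsum]
  · refine finsum_congr fun μ => ?_
    rw [muBinom_eq_divDiff _ _ _ fun i => weights_pos hdiag hpos (μ i)]
    change _ = L _
    rw [map_smul]
    rfl
  · refine (finite_nablaMulti_ne_zero hdiag k Y).subset fun μ hμ h0 => hμ ?_
    dsimp only
    rw [h0, smul_zero]

theorem coeffMap_zero_cpow (hpos : HasPositiveEigenvalues 𝒟.θ) (z : ℂ) (Y : 𝒟.Alg) :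
    𝒟.coeffMap hdiag 0 (fun s => s ^ z) Y = diagCPow 𝒟.θ hdiag (r * z) Y := by
  rw [diagCPow_eq_eigenLift]
  refine hdiag.induction_on (p := ⊤) (fun _ _ => trivial)
    (P := fun Y => 𝒟.coeffMap hdiag 0 (fun s => s ^ z) Y =
      eigenLift hdiag (fun c => c ^ (r * z) • LinearMap.id) Y) (by simp) ?_ ?_ (x := Y) trivial
  · intro X Y hX hY
    rw [map_add, map_add, hX, hY]
  · intro c hc X _ hX
    obtain ⟨x, hx, rfl⟩ := hpos c hc
    have hXr : X ∈ (𝒟.θ ^ r).eigenspace ((x : ℂ) ^ r) :=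
      Module.End.mem_eigenspace_iff.2 (pow_apply_of_mem_eigenspace hX r)
    rw [coeffMap_zero_apply _ _ hXr, eigenLift_apply _ _ hX, LinearMap.smul_apply,
      LinearMap.id_apply]
    congr 1
    -- For `x > 0` this product is real, hence inside the principal strip, and `(x ^ r) ^ z = x ^ (r
    -- z)` holds without a branch correction.
    have him : (Complex.log (x : ℂ) * (r : ℂ)).im = 0 := by
      rw [← Complex.ofReal_log hx.le, ← Complex.ofReal_natCast, ← Complex.ofReal_mul,
        Complex.ofReal_im]
    rw [Complex.cpow_mul _ (by rw [him]; linarith [Real.pi_pos])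
      (by rw [him]; exact Real.pi_pos.le),
      Complex.cpow_natCast]

end TwistedDOAlgebra

/-! ### Scalar integrals of Stieltjes type -/

section Stieltjes

open MeasureTheory Set Filter Topology

/-- The product of the numbers `(x + μ)⁻¹` over the nodes `μ`. -/
def poleProd (ν : List ℝ) (x : ℝ) : ℂ := (ν.map fun μ : ℝ => ((x : ℂ) + μ)⁻¹).prod

/-- The integral of `x ^ (-a)` times the product of the `(x + μ)⁻¹` over the nodes `μ`. -/
def stieltjes (a : ℂ) (ν : List ℝ) : ℂ := ∫ x in Ioi (0 : ℝ), (x : ℂ) ^ (-a) * poleProd ν x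

theorem poleProd_nil (x : ℝ) : poleProd [] x = 1 := rfl

theorem poleProd_cons (μ : ℝ) (ν : List ℝ) (x : ℝ) :
    poleProd (μ :: ν) x = ((x : ℂ) + μ)⁻¹ * poleProd ν x := by
  rw [poleProd, List.map_cons, List.prod_cons, poleProd]

theorem norm_ofReal_add_inv {x μ : ℝ} (hx : 0 < x) (hμ : 0 < μ) :
    ‖((x : ℂ) + μ)⁻¹‖ = (x + μ)⁻¹ := by
  rw [← Complex.ofReal_add, ← Complex.ofReal_inv, Complex.norm_real, Real.norm_of_nonneg]
  positivity

theorem exists_norm_poleProd_le {ν : List ℝ} (hν : ∀ μ ∈ ν, 0 < μ) :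
    ∃ c : ℝ, 0 ≤ c ∧ ∀ x : ℝ, 0 < x → ‖poleProd ν x‖ ≤ c := by
  induction ν with
  | nil => exact ⟨1, zero_le_one, fun x _ => by simp [poleProd_nil]⟩
  | cons μ ν ih =>
    obtain ⟨c, hc, h⟩ := ih fun κ hκ => hν κ (List.mem_cons_of_mem _ hκ)
    have hμ := hν μ List.mem_cons_self
    refine ⟨μ⁻¹ * c, by positivity, fun x hx => ?_⟩
    rw [poleProd_cons, norm_mul, norm_ofReal_add_inv hx hμ]
    gcongr
    · linarith
    · exact h x hx

theorem inv_add_le {x μ : ℝ} (hx : 0 < x) (hμ : 0 < μ) :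
    (x + μ)⁻¹ ≤ (1 + μ⁻¹) * (x + 1)⁻¹ := by
  rw [← div_eq_mul_inv, inv_eq_one_div, div_le_div_iff₀ (by positivity) (by positivity)]
  have : (1 + μ⁻¹) * (x + μ) = x + 1 + (μ + x * μ⁻¹) := by field_simp; ring
  rw [this, one_mul]
  have : 0 < μ + x * μ⁻¹ := by positivity
  linarith

theorem exists_norm_poleProd_cons_le {μ : ℝ} {ν : List ℝ} (hν : ∀ κ ∈ μ :: ν, 0 < κ) :
    ∃ c : ℝ, 0 ≤ c ∧ ∀ x : ℝ, 0 < x → ‖poleProd (μ :: ν) x‖ ≤ c * (x + 1)⁻¹ := by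
  obtain ⟨c, hc, h⟩ := exists_norm_poleProd_le fun κ hκ => hν κ (List.mem_cons_of_mem _ hκ)
  have hμ := hν μ List.mem_cons_self
  refine ⟨(1 + μ⁻¹) * c, by positivity, fun x hx => ?_⟩
  rw [poleProd_cons, norm_mul, norm_ofReal_add_inv hx hμ, mul_right_comm]
  gcongr
  · exact inv_add_le hx hμ
  · exact h x hx

/-- This is the common dominating function of the integrals below: `x < 1` is used at the origin and
`x > 0` at infinity. -/
theorem integrableOn_rpow_mul_inv_add_one {x : ℝ} (hx0 : 0 < x) (hx1 : x < 1) :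
    IntegrableOn (fun t : ℝ => t ^ (-x) * (t + 1)⁻¹) (Ioi 0) := by
  have hmeas : Measurable fun t : ℝ => t ^ (-x) * (t + 1)⁻¹ := by fun_prop
  rw [← Ioc_union_Ioi_eq_Ioi zero_le_one, integrableOn_union]
  constructor
  · have h := (intervalIntegral.intervalIntegrable_rpow' (a := 0) (b := 1)
      (by linarith : -1 < -x)).1
    refine Integrable.mono' h hmeas.aestronglyMeasurable ?_
    filter_upwards [ae_restrict_mem measurableSet_Ioc] with t ht
    have h1 : 0 ≤ t ^ (-x) := Real.rpow_nonneg ht.1.le _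
    have h2 : (t + 1)⁻¹ ≤ 1 := inv_le_one_of_one_le₀ (by linarith [ht.1])
    have h3 : 0 ≤ (t + 1)⁻¹ := inv_nonneg.2 (by linarith [ht.1])
    rw [Real.norm_of_nonneg (mul_nonneg h1 h3)]
    exact mul_le_of_le_one_right h1 h2
  · have h := integrableOn_Ioi_rpow_of_lt (by linarith : -x - 1 < -1) zero_lt_one
    refine Integrable.mono' h hmeas.aestronglyMeasurable ?_
    filter_upwards [ae_restrict_mem measurableSet_Ioi] with t ht
    have ht0 : 0 < t := zero_lt_one.trans ht
    have h1 : 0 ≤ t ^ (-x) := Real.rpow_nonneg ht0.le _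
    have h3 : 0 ≤ (t + 1)⁻¹ := inv_nonneg.2 (by linarith)
    rw [Real.norm_of_nonneg (mul_nonneg h1 h3), Real.rpow_sub_one ht0.ne', div_eq_mul_inv]
    gcongr
    linarith

theorem norm_ofReal_cpow_neg {x : ℝ} (hx : 0 < x) (a : ℂ) : ‖(x : ℂ) ^ (-a)‖ = x ^ (-a.re) := by
  rw [Complex.norm_cpow_eq_rpow_re_of_pos hx, Complex.neg_re]

theorem continuousOn_ofReal_cpow (a : ℂ) : ContinuousOn (fun x : ℝ => (x : ℂ) ^ a) (Ioi 0) :=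
  fun x hx => (Complex.continuousAt_ofReal_cpow_const x a (Or.inr (ne_of_gt hx))).continuousWithinAt

theorem continuousOn_poleProd {ν : List ℝ} (hν : ∀ μ ∈ ν, 0 < μ) :
    ContinuousOn (poleProd ν) (Ioi 0) := by
  induction ν with
  | nil => exact continuousOn_const
  | cons μ ν ih =>
    have : poleProd (μ :: ν) = fun x : ℝ => ((x : ℂ) + μ)⁻¹ * poleProd ν x :=
      funext (poleProd_cons μ ν)
    rw [this]
    refine ContinuousOn.mul ?_ (ih fun κ hκ => hν κ (List.mem_cons_of_mem _ hκ))
    refine ContinuousOn.inv₀ (by fun_prop) fun x hx => ?_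
    have hμ := hν μ List.mem_cons_self
    rw [← Complex.ofReal_add]
    exact Complex.ofReal_ne_zero.2 (ne_of_gt (add_pos hx hμ))

theorem integrableOn_stieltjes {a : ℂ} (ha0 : 0 < a.re) (ha1 : a.re < 1) {μ : ℝ} {ν : List ℝ}
    (hν : ∀ κ ∈ μ :: ν, 0 < κ) :
    IntegrableOn (fun x : ℝ => (x : ℂ) ^ (-a) * poleProd (μ :: ν) x) (Ioi 0) := by
  obtain ⟨c, hc, h⟩ := exists_norm_poleProd_cons_le hν
  refine Integrable.mono' ((integrableOn_rpow_mul_inv_add_one ha0 ha1).const_mul c)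
    (((continuousOn_ofReal_cpow _).mul (continuousOn_poleProd hν)).aestronglyMeasurable
      measurableSet_Ioi) ?_
  filter_upwards [ae_restrict_mem measurableSet_Ioi] with x hx
  have h1 := h x hx
  rw [norm_mul, norm_ofReal_cpow_neg hx]
  calc x ^ (-a.re) * ‖poleProd (μ :: ν) x‖ ≤ x ^ (-a.re) * (c * (x + 1)⁻¹) := by
        gcongr
        exact Real.rpow_nonneg (le_of_lt hx) _
    _ = c * (x ^ (-a.re) * (x + 1)⁻¹) := by ring

/-- The integrated resolvent identity `(x + s)⁻¹ - (x + μ)⁻¹ = -(s - μ) (x + s)⁻¹ (x + μ)⁻¹`; it is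
why a divided difference adds a node. -/
theorem stieltjes_sub {a : ℂ} (ha0 : 0 < a.re) (ha1 : a.re < 1) {s μ : ℝ} {ν : List ℝ}
    (hs : 0 < s) (hμ : 0 < μ) (hν : ∀ κ ∈ ν, 0 < κ) :
    stieltjes a (s :: ν) - stieltjes a (μ :: ν) = -((s : ℂ) - μ) * stieltjes a (s :: μ :: ν) := by
  rw [stieltjes, stieltjes, stieltjes, ← integral_sub, ← integral_const_mul]
  · refine setIntegral_congr_fun measurableSet_Ioi fun x hx => ?_
    have h1 : (x : ℂ) + s ≠ 0 := by
      rw [← Complex.ofReal_add]; exact Complex.ofReal_ne_zero.2 (ne_of_gt (add_pos hx hs))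
    have h2 : (x : ℂ) + μ ≠ 0 := by
      rw [← Complex.ofReal_add]; exact Complex.ofReal_ne_zero.2 (ne_of_gt (add_pos hx hμ))
    simp only [poleProd_cons]
    field_simp
    ring
  · exact integrableOn_stieltjes ha0 ha1 (by simpa [hs] using hν)
  · exact integrableOn_stieltjes ha0 ha1 (by simpa [hμ] using hν)

theorem exists_norm_stieltjes_le {a : ℂ} (ha0 : 0 < a.re) (ha1 : a.re < 1) {μ : ℝ} {ν : List ℝ}
    (hν : ∀ κ ∈ μ :: ν, 0 < κ) :
    ∃ c : ℝ, ∀ s : ℝ, 0 < s → ‖stieltjes a (s :: μ :: ν)‖ ≤ s⁻¹ * c := by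
  refine ⟨∫ x in Ioi (0 : ℝ), ‖(x : ℂ) ^ (-a) * poleProd (μ :: ν) x‖, fun s hs => ?_⟩
  rw [← integral_const_mul]
  refine norm_integral_le_of_norm_le
    ((integrableOn_stieltjes ha0 ha1 hν).norm.const_mul _) ?_
  filter_upwards [ae_restrict_mem measurableSet_Ioi] with x hx
  rw [poleProd_cons, mul_left_comm, norm_mul, norm_ofReal_add_inv hx hs]
  gcongr
  linarith [mem_Ioi.1 hx]

/-- Divided differences of Stieltjes functions are Stieltjes functions. -/
theorem dslope_eq_stieltjes {a : ℂ} (ha0 : 0 < a.re) (ha1 : a.re < 1) {μ : ℝ} {ν : List ℝ}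
    (hμ : 0 < μ) (hν : ∀ κ ∈ ν, 0 < κ) {f : ℂ → ℂ} (hf : DifferentiableOn ℂ f rightHalfPlane)
    {c : ℂ} (hfs : ∀ s : ℝ, 0 < s → f s = c * stieltjes a (s :: ν)) {s : ℝ} (hs : 0 < s) :
    dslope f μ s = -c * stieltjes a (s :: μ :: ν) := by
  have hne : ∀ s : ℝ, 0 < s → s ≠ μ → dslope f μ s = -c * stieltjes a (s :: μ :: ν) := by
    intro s hs hsμ
    have h0 : (s : ℂ) - μ ≠ 0 := sub_ne_zero.2 fun h => hsμ (Complex.ofReal_injective h)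
    rw [dslope_of_ne _ fun h => hsμ (Complex.ofReal_injective h), slope_def_field, hfs s hs,
      hfs μ hμ, ← mul_sub, stieltjes_sub ha0 ha1 hs hμ hν]
    field_simp
  -- At a repeated node `dslope` is a derivative. The formula follows there by letting `t → s`
  -- through `t ≠ s`, since both sides are continuous at `s`.
  by_cases hsμ : s = μ
  · subst hsμ
    have hpos : ∀ᶠ t : ℝ in 𝓝[≠] s, 0 < t := nhdsWithin_le_nhds (eventually_gt_nhds hs)
    have hl1 : Tendsto (fun t : ℝ => dslope f s t) (𝓝[≠] s) (𝓝 (dslope f s s)) := by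
      have hd : DifferentiableAt ℂ f s :=
        hf.differentiableAt (isOpen_rightHalfPlane.mem_nhds (ofReal_mem_rightHalfPlane hs))
      have hc : ContinuousAt (fun t : ℝ => dslope f s t) s :=
        (continuousAt_dslope_same.2 hd).comp Complex.continuous_ofReal.continuousAt
      exact hc.tendsto.mono_left nhdsWithin_le_nhds
    obtain ⟨b, hb⟩ := exists_norm_stieltjes_le (a := a) ha0 ha1 (μ := s) (ν := s :: ν)
      (by simpa [hs] using hν)
    have hl2 : Tendsto (fun t : ℝ => stieltjes a (t :: s :: ν)) (𝓝[≠] s)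
        (𝓝 (stieltjes a (s :: s :: ν))) := by
      rw [tendsto_iff_norm_sub_tendsto_zero]
      have hz : Tendsto (fun t : ℝ => |t - s| * (t⁻¹ * b)) (𝓝[≠] s) (𝓝 0) := by
        have : ContinuousAt (fun t : ℝ => |t - s| * (t⁻¹ * b)) s := by
          have := continuousAt_inv₀ hs.ne'
          fun_prop
        have h := this.tendsto.mono_left (nhdsWithin_le_nhds (s := {s}ᶜ))
        simpa using h
      refine squeeze_zero' (Eventually.of_forall fun _ => norm_nonneg _) ?_ hz
      filter_upwards [hpos] with t ht
      rw [stieltjes_sub ha0 ha1 ht hs (by simpa [hs] using hν), norm_mul, norm_neg,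
        ← Complex.ofReal_sub, Complex.norm_real, Real.norm_eq_abs]
      exact mul_le_mul_of_nonneg_left (hb t ht) (abs_nonneg _)
    refine tendsto_nhds_unique hl1 ((hl2.const_mul (-c)).congr' ?_)
    filter_upwards [hpos, self_mem_nhdsWithin] with t ht hts
    exact (hne t ht hts).symm
  · exact hne s hs hsμ

/-! ### Homogeneity and the normalising constant -/

theorem poleProd_mul (ν : List ℝ) (t x : ℝ) :
    (ν.map fun μ : ℝ => (t : ℂ) / (x * t + μ)).prod = (t : ℂ) ^ ν.length * poleProd ν (t * x) := by
  induction ν with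
  | nil => simp [poleProd_nil]
  | cons μ ν ih =>
    rw [List.map_cons, List.prod_cons, ih, poleProd_cons, List.length_cons, pow_succ',
      div_eq_mul_inv]
    push_cast
    rw [mul_comm (x : ℂ) t]
    ring

/-- Since `t / (x t + μ)` is `(x + μ / t)⁻¹`, this is the resolvent integral with `Δ` replaced by
the number `1 / t`. The change of variables `x ↦ t x` makes the dependence on `t` a pure power. -/
theorem integral_cpow_mul_prod {a : ℂ} (ν : List ℝ) {t : ℝ} (ht : 0 < t) :
    ∫ x in Ioi (0 : ℝ), (x : ℂ) ^ (-a) * (ν.map fun μ : ℝ => (t : ℂ) / (x * t + μ)).prod =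
      stieltjes a ν * (t : ℂ) ^ (a + ν.length - 1) := by
  have ht' : (t : ℂ) ≠ 0 := Complex.ofReal_ne_zero.2 ht.ne'
  have h1 := integral_comp_mul_left_Ioi (fun x : ℝ => (x : ℂ) ^ (-a) * poleProd ν x) 0 ht
  rw [mul_zero] at h1
  have h2 : ∫ x in Ioi (0 : ℝ), (x : ℂ) ^ (-a) * (ν.map fun μ : ℝ => (t : ℂ) / (x * t + μ)).prod =
      ∫ x in Ioi (0 : ℝ), (t : ℂ) ^ (a + ν.length) *
        (((t * x : ℝ) : ℂ) ^ (-a) * poleProd ν (t * x)) := by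
    refine setIntegral_congr_fun measurableSet_Ioi fun x hx => ?_
    rw [poleProd_mul ν t, Complex.ofReal_mul, Complex.mul_cpow_ofReal_nonneg ht.le (le_of_lt hx),
      Complex.cpow_add _ _ ht', Complex.cpow_natCast, Complex.cpow_neg]
    have : (t : ℂ) ^ a ≠ 0 := by simp [Complex.cpow_eq_zero_iff, ht']
    rw [Complex.cpow_neg (t : ℂ)]
    field_simp
  rw [h2, integral_const_mul, h1, Complex.cpow_sub _ _ ht', Complex.cpow_one, stieltjes,
    Complex.real_smul, Complex.ofReal_inv]
  field_simp

theorem stieltjes_singleton {a : ℂ} {s : ℝ} (hs : 0 < s) :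
    stieltjes a [s] = stieltjes a [1] * (s : ℂ) ^ (-a) := by
  have h := integral_cpow_mul_prod (a := a) [1] (inv_pos.2 hs)
  have h1 : ∫ x in Ioi (0 : ℝ), (x : ℂ) ^ (-a) *
      ([1].map fun μ : ℝ => ((s⁻¹ : ℝ) : ℂ) / (x * ((s⁻¹ : ℝ) : ℂ) + μ)).prod =
        stieltjes a [s] := by
    rw [stieltjes]
    refine setIntegral_congr_fun measurableSet_Ioi fun x hx => ?_
    have hs' : (s : ℂ) ≠ 0 := Complex.ofReal_ne_zero.2 hs.ne'
    have h2 : (x : ℂ) + s ≠ 0 := by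
      rw [← Complex.ofReal_add]; exact Complex.ofReal_ne_zero.2 (ne_of_gt (add_pos hx hs))
    simp [poleProd_cons, poleProd_nil]
    field_simp
    simp
  rw [← h1, h, List.length_singleton, Nat.cast_one, add_sub_cancel_right, Complex.ofReal_inv,
    Complex.inv_cpow_eq_ite, Complex.arg_ofReal_of_nonneg hs.le, if_neg Real.pi_pos.ne,
    Complex.cpow_neg]

/-- The substitution `x ↦ x / (1 - x)` turns the integral into `B(1 - a, a) = Γ(1 - a) Γ(a)`, a
product of nonzero Gamma values. -/
theorem stieltjes_one_ne_zero {a : ℂ} (ha0 : 0 < a.re) (ha1 : a.re < 1) : stieltjes a [1] ≠ 0 := by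
  have hb : 0 < (1 - a).re := by simpa using ha1
  have hbeta : Complex.betaIntegral (1 - a) a = stieltjes a [1] := by
    let φ : ℝ → ℝ := fun x => x / (1 - x)
    have himg : φ '' Ioo 0 1 = Ioi 0 := by
      ext y
      constructor
      · rintro ⟨x, hx, rfl⟩
        exact div_pos hx.1 (by linarith [hx.2])
      · intro hy
        have hy' : 0 < y := hy
        refine ⟨y / (1 + y), ⟨by positivity, by rw [div_lt_one (by positivity)]; linarith⟩, ?_⟩
        simp only [φ]
        field_simp
        simp
    have hder : ∀ x ∈ Ioo (0 : ℝ) 1, HasDerivWithinAt φ (((1 - x) ^ 2)⁻¹) (Ioo 0 1) x := by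
      intro x hx
      have h1 : (1 : ℝ) - x ≠ 0 := by linarith [hx.2]
      have := ((hasDerivAt_id x).div ((hasDerivAt_const x (1 : ℝ)).sub (hasDerivAt_id x)) h1)
      refine (this.congr_deriv ?_).hasDerivWithinAt
      simp
    have hinj : InjOn φ (Ioo 0 1) := by
      intro x hx y hy h
      have h1 : (1 : ℝ) - x ≠ 0 := by linarith [hx.2]
      have h2 : (1 : ℝ) - y ≠ 0 := by linarith [hy.2]
      simp only [φ] at h
      rw [div_eq_div_iff h1 h2] at h
      linarith
    rw [stieltjes, ← himg, integral_image_eq_integral_abs_deriv_smul measurableSet_Ioo hder hinj,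
      Complex.betaIntegral, intervalIntegral.integral_of_le zero_le_one,
      integral_Ioc_eq_integral_Ioo]
    refine setIntegral_congr_fun measurableSet_Ioo fun x hx => ?_
    have hx0 : 0 < x := hx.1
    have hx1 : 0 < 1 - x := by linarith [hx.2]
    have hx1' : (1 : ℂ) - x ≠ 0 := by
      rw [← Complex.ofReal_one, ← Complex.ofReal_sub]
      exact Complex.ofReal_ne_zero.2 hx1.ne'
    dsimp only [φ]
    rw [abs_of_pos (by positivity), poleProd_cons, poleProd_nil, mul_one, Complex.real_smul,
      div_eq_mul_inv x, Complex.ofReal_mul, Complex.mul_cpow_ofReal_nonneg hx0.le (by positivity),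
      Complex.ofReal_inv (1 - x), Complex.inv_cpow_eq_ite, Complex.arg_ofReal_of_nonneg hx1.le,
      if_neg Real.pi_pos.ne, Complex.cpow_neg _ a, Complex.cpow_neg _ a, inv_inv,
      Complex.cpow_sub _ _ hx1', Complex.cpow_one]
    have e1 : (1 : ℂ) - a - 1 = -a := by ring
    rw [e1, Complex.cpow_neg]
    push_cast
    have hxa : (x : ℂ) ^ a ≠ 0 := by simp [Complex.cpow_eq_zero_iff, hx0.ne']
    have e2 : (x : ℂ) * (1 - (x : ℂ))⁻¹ + 1 = (1 - (x : ℂ))⁻¹ := by field_simp; ring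
    rw [e2, inv_inv]
    field_simp
  rw [← hbeta, Complex.betaIntegral_eq_Gamma_mul_div _ _ hb ha0, sub_add_cancel, Complex.Gamma_one,
    div_one]
  exact mul_ne_zero (Complex.Gamma_ne_zero_of_re_pos hb) (Complex.Gamma_ne_zero_of_re_pos ha0)

end Stieltjes

namespace AbstractLaplace

open MeasureTheory Set Filter Topology

variable {H : Type*} [NormedAddCommGroup H] [InnerProductSpace ℂ H] [CompleteSpace H]
variable (Δ : AbstractLaplace H)

/-! ### Products of resolvents -/

theorem commute_cfc_inv (f : ℂ → ℂ) : Commute (cfc f Δ.inv) Δ.inv := by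
  have := Δ.isStarNormal_inv
  have h := cfc_commute_cfc (R := ℂ) f id Δ.inv
  rwa [cfc_id ℂ Δ.inv] at h

/-- The symbol of a product of resolvents `(x + μ Δ)⁻¹` as a function of `t = Δ⁻¹`. -/
def resSymbol (ν : List ℝ) (x : ℝ) (t : ℂ) : ℂ := (ν.map fun μ : ℝ => t / (x * t + μ)).prod

/-- The product of the resolvents `(x + μ Δ)⁻¹` over the nodes `μ`. -/
def resProd (ν : List ℝ) (x : ℝ) : H →L[ℂ] H := cfc (resSymbol ν x) Δ.inv

/-- The product of the resolvents `(x + μ Δ)⁻¹` over the nodes `μ`, on `H^∞`. -/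
def resEnd (ν : List ℝ) (x : ℝ) : Module.End ℂ Δ.smooth :=
  Δ.restr (Δ.resProd ν x) (Δ.commute_cfc_inv _)

theorem coe_resEnd (ν : List ℝ) (x : ℝ) (v : Δ.smooth) :
    (Δ.resEnd ν x v : H) = Δ.resProd ν x v := rfl

theorem resSymbol_nil (x : ℝ) (t : ℂ) : resSymbol [] x t = 1 := rfl

theorem resSymbol_cons (μ : ℝ) (ν : List ℝ) (x : ℝ) (t : ℂ) :
    resSymbol (μ :: ν) x t = t / (x * t + μ) * resSymbol ν x t := by
  rw [resSymbol, List.map_cons, List.prod_cons, resSymbol]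

theorem mul_add_ne_zero {x μ : ℝ} (hx : 0 < x) (hμ : 0 < μ) {t : ℂ} (ht : t ∈ spectrum ℂ Δ.inv) :
    (x : ℂ) * t + μ ≠ 0 := by
  obtain ⟨t, ht0, -, rfl⟩ := Δ.spectrum_inv ht
  rw [← Complex.ofReal_mul, ← Complex.ofReal_add]
  exact Complex.ofReal_ne_zero.2 (by positivity)

/-- Joint continuity is needed to interchange the functional calculus with the integral over `x`. -/
theorem continuousOn_uncurry_resSymbol {ν : List ℝ} (hν : ∀ μ ∈ ν, 0 < μ) :
    ContinuousOn (Function.uncurry (resSymbol ν)) (Ioi 0 ×ˢ spectrum ℂ Δ.inv) := by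
  induction ν with
  | nil => exact continuousOn_const
  | cons μ ν ih =>
    have : Function.uncurry (resSymbol (μ :: ν)) = fun q : ℝ × ℂ =>
        q.2 / (q.1 * q.2 + μ) * Function.uncurry (resSymbol ν) q :=
      funext fun q => resSymbol_cons μ ν q.1 q.2
    rw [this]
    refine ContinuousOn.mul (ContinuousOn.div (by fun_prop) (by fun_prop) ?_)
      (ih fun κ hκ => hν κ (List.mem_cons_of_mem _ hκ))
    exact fun q hq => Δ.mul_add_ne_zero hq.1 (hν μ List.mem_cons_self) hq.2

theorem continuousOn_resSymbol {ν : List ℝ} (hν : ∀ μ ∈ ν, 0 < μ) {x : ℝ} (hx : 0 < x) :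
    ContinuousOn (resSymbol ν x) (spectrum ℂ Δ.inv) :=
  (Δ.continuousOn_uncurry_resSymbol hν).comp (f := fun t : ℂ => (x, t)) (by fun_prop)
    fun _ ht => ⟨hx, ht⟩

theorem resProd_nil (x : ℝ) : Δ.resProd [] x = 1 := by
  have := Δ.isStarNormal_inv
  exact cfc_const_one ℂ Δ.inv

theorem resProd_cons {μ : ℝ} {ν : List ℝ} (hν : ∀ κ ∈ μ :: ν, 0 < κ) {x : ℝ} (hx : 0 < x) :
    Δ.resProd (μ :: ν) x = Δ.resProd [μ] x * Δ.resProd ν x := by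
  rw [resProd, resProd, resProd, ← cfc_mul _ _ _
    (Δ.continuousOn_resSymbol (by simpa using hν μ List.mem_cons_self) hx)
    (Δ.continuousOn_resSymbol (fun κ hκ => hν κ (List.mem_cons_of_mem _ hκ)) hx)]
  congr 1
  ext t
  rw [resSymbol_cons, resSymbol_cons, resSymbol_nil, mul_one]

/-- Uses `t (x + 1) ≤ x t + ‖Δ⁻¹‖` on the spectrum. One such factor supplies all the decay in `x`;
the others only have to stay bounded. -/
theorem exists_norm_resSymbol_singleton_le {μ : ℝ} (hμ : 0 < μ) :
    ∃ c : ℝ, 0 ≤ c ∧ ∀ x : ℝ, 0 < x → ∀ t ∈ spectrum ℂ Δ.inv,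
      ‖t / (x * t + μ)‖ ≤ c * (x + 1)⁻¹ := by
  refine ⟨1 + ‖Δ.inv‖ / μ, by positivity, fun x hx t ht => ?_⟩
  obtain ⟨t, ht0, htK, rfl⟩ := Δ.spectrum_inv ht
  rw [← Complex.ofReal_mul, ← Complex.ofReal_add, ← Complex.ofReal_div, Complex.norm_real,
    Real.norm_of_nonneg (by positivity), ← div_eq_mul_inv,
    div_le_div_iff₀ (by positivity) (by positivity)]
  have : (1 + ‖Δ.inv‖ / μ) * (x * t + μ) =
      x * t + ‖Δ.inv‖ + (μ + ‖Δ.inv‖ / μ * (x * t)) := by field_simp; ring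
  rw [this]
  have : 0 ≤ μ + ‖Δ.inv‖ / μ * (x * t) := by positivity
  linarith

theorem exists_norm_resSymbol_le {ν : List ℝ} (hν : ∀ μ ∈ ν, 0 < μ) :
    ∃ c : ℝ, 0 ≤ c ∧ ∀ x : ℝ, 0 < x → ∀ t ∈ spectrum ℂ Δ.inv, ‖resSymbol ν x t‖ ≤ c := by
  induction ν with
  | nil => exact ⟨1, zero_le_one, fun x _ t _ => by simp [resSymbol_nil]⟩
  | cons μ ν ih =>
    obtain ⟨c, hc, h⟩ := ih fun κ hκ => hν κ (List.mem_cons_of_mem _ hκ)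
    obtain ⟨d, hd, h'⟩ := Δ.exists_norm_resSymbol_singleton_le (hν μ List.mem_cons_self)
    refine ⟨d * c, by positivity, fun x hx t ht => ?_⟩
    rw [resSymbol_cons, norm_mul]
    refine mul_le_mul ((h' x hx t ht).trans ?_) (h x hx t ht) (norm_nonneg _) hd
    exact mul_le_of_le_one_right hd (inv_le_one_of_one_le₀ (by linarith))

theorem exists_norm_resSymbol_cons_le {μ : ℝ} {ν : List ℝ} (hν : ∀ κ ∈ μ :: ν, 0 < κ) :
    ∃ c : ℝ, 0 ≤ c ∧ ∀ x : ℝ, 0 < x → ∀ t ∈ spectrum ℂ Δ.inv,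
      ‖resSymbol (μ :: ν) x t‖ ≤ c * (x + 1)⁻¹ := by
  obtain ⟨c, hc, h⟩ := Δ.exists_norm_resSymbol_le fun κ hκ => hν κ (List.mem_cons_of_mem _ hκ)
  obtain ⟨d, hd, h'⟩ := Δ.exists_norm_resSymbol_singleton_le (hν μ List.mem_cons_self)
  refine ⟨d * c, by positivity, fun x hx t ht => ?_⟩
  rw [resSymbol_cons, norm_mul, mul_right_comm]
  exact mul_le_mul (h' x hx t ht) (h x hx t ht) (norm_nonneg _) (by positivity)

theorem exists_norm_resProd_cons_le {μ : ℝ} {ν : List ℝ} (hν : ∀ κ ∈ μ :: ν, 0 < κ) :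
    ∃ c : ℝ, 0 ≤ c ∧ ∀ x : ℝ, 0 < x → ‖Δ.resProd (μ :: ν) x‖ ≤ c * (x + 1)⁻¹ := by
  obtain ⟨c, hc, h⟩ := Δ.exists_norm_resSymbol_cons_le hν
  exact ⟨c, hc, fun x hx => norm_cfc_le (by positivity) (h x hx)⟩

theorem continuousOn_resProd_singleton {μ : ℝ} (hμ : 0 < μ) :
    ContinuousOn (Δ.resProd [μ]) (Ioi 0) := by
  have hsing : ∀ κ ∈ [μ], 0 < κ := by simpa using hμ
  -- By the resolvent identity the difference is `y - x` times two resolvents, each bounded by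
  -- `‖Δ⁻¹‖ / μ`.
  refine (LipschitzOnWith.of_dist_le_mul (K := Real.toNNReal ((‖Δ.inv‖ / μ) ^ 2)) ?_).continuousOn
  intro x hx y hy
  have hx' : 0 < x := hx
  have hy' : 0 < y := hy
  rw [dist_eq_norm, resProd, resProd, ← cfc_sub _ _ _ (Δ.continuousOn_resSymbol hsing hx)
    (Δ.continuousOn_resSymbol hsing hy), Real.coe_toNNReal _ (by positivity)]
  refine norm_cfc_le (by positivity) fun t ht => ?_
  have hxt := Δ.mul_add_ne_zero hx hμ ht
  have hyt := Δ.mul_add_ne_zero hy hμ ht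
  obtain ⟨t, ht0, htK, rfl⟩ := Δ.spectrum_inv ht
  have e : resSymbol [μ] x t - resSymbol [μ] y t =
      ((t / (x * t + μ) * (t / (y * t + μ)) : ℝ) : ℂ) * ((y - x : ℝ) : ℂ) := by
    simp only [resSymbol_cons, resSymbol_nil, mul_one]
    push_cast
    rw [div_sub_div _ _ hxt hyt, div_mul_div_comm, div_mul_eq_mul_div]
    congr 1
    ring
  have hb : ∀ x : ℝ, 0 < x → t / (x * t + μ) ≤ ‖Δ.inv‖ / μ := fun x hx => by
    gcongr
    nlinarith [mul_nonneg hx.le ht0]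
  rw [e, norm_mul, Complex.norm_real, Complex.norm_real, Real.norm_of_nonneg (by positivity),
    Real.norm_eq_abs, Real.dist_eq, abs_sub_comm, pow_two]
  refine mul_le_mul_of_nonneg_right ?_ (abs_nonneg _)
  exact mul_le_mul (hb x hx) (hb y hy) (by positivity) (by positivity)

theorem continuousOn_resProd {ν : List ℝ} (hν : ∀ μ ∈ ν, 0 < μ) :
    ContinuousOn (Δ.resProd ν) (Ioi 0) := by
  induction ν with
  | nil => exact continuousOn_const.congr fun x _ => Δ.resProd_nil x
  | cons μ ν ih =>
    refine ContinuousOn.congr ?_ fun x hx => Δ.resProd_cons hν hx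
    exact (Δ.continuousOn_resProd_singleton (hν μ List.mem_cons_self)).mul
      (ih fun κ hκ => hν κ (List.mem_cons_of_mem _ hκ))

theorem cpow_neg_one : Δ.cpow (-1) = Δ.restr Δ.inv (Commute.refl _) := by
  have h : Δ.op * Δ.cpow (-1) = 1 := by rw [← cpow_one, ← cpow_add, add_neg_cancel, cpow_zero]
  rw [← one_mul (Δ.cpow (-1)), ← restr_inv_mul_op, mul_assoc, h, mul_one]

theorem resProd_singleton_apply {μ : ℝ} (hμ : 0 < μ) {x : ℝ} (hx : 0 < x) :
    Δ.resProd [μ] x = cfc (fun t : ℂ => (x * t + μ)⁻¹) Δ.inv * Δ.inv := by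
  have hn := Δ.isStarNormal_inv
  have hc : ContinuousOn (fun t : ℂ => ((x : ℂ) * t + μ)⁻¹) (spectrum ℂ Δ.inv) :=
    ContinuousOn.inv₀ (by fun_prop) fun t ht => Δ.mul_add_ne_zero hx hμ ht
  have hmul := cfc_mul (fun t : ℂ => ((x : ℂ) * t + μ)⁻¹) (fun t => t) Δ.inv hc continuousOn_id
  rw [cfc_id' ℂ Δ.inv] at hmul
  rw [← hmul, resProd]
  congr 1
  ext t
  rw [resSymbol_cons, resSymbol_nil, mul_one, div_eq_mul_inv, mul_comm]

/-- Writing `(x + μ Δ)⁻¹ = (x Δ⁻¹ + μ)⁻¹ Δ⁻¹`, with first factor of norm at most `μ⁻¹`, each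
resolvent gains a full power `Δ⁻¹` uniformly in `x`, at the price of its decay in `x`. -/
theorem exists_norm_resEnd_le {ν : List ℝ} (hν : ∀ μ ∈ ν, 0 < μ) :
    ∃ c : ℝ, 0 ≤ c ∧ ∀ x : ℝ, 0 < x → ∀ v : Δ.smooth,
      ‖(Δ.resEnd ν x v : H)‖ ≤ c * ‖(Δ.cpow (-ν.length) v : H)‖ := by
  induction ν with
  | nil =>
    refine ⟨1, zero_le_one, fun x _ v => ?_⟩
    rw [coe_resEnd, resProd_nil, List.length_nil, Nat.cast_zero, neg_zero, cpow_zero, one_mul]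
    rfl
  | cons μ ν ih =>
    obtain ⟨c, hc, h⟩ := ih fun κ hκ => hν κ (List.mem_cons_of_mem _ hκ)
    have hμ := hν μ List.mem_cons_self
    refine ⟨μ⁻¹ * c, by positivity, fun x hx v => ?_⟩
    have hcomm : Commute (Δ.resProd ν x) Δ.inv := Δ.commute_cfc_inv _
    have hg : ‖cfc (fun t : ℂ => (x * t + μ)⁻¹) Δ.inv‖ ≤ μ⁻¹ := by
      refine norm_cfc_le (by positivity) fun t ht => ?_
      obtain ⟨t, ht0, -, rfl⟩ := Δ.spectrum_inv ht
      rw [← Complex.ofReal_mul, ← Complex.ofReal_add, ← Complex.ofReal_inv, Complex.norm_real,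
        Real.norm_of_nonneg (by positivity)]
      gcongr
      nlinarith [mul_nonneg hx.le ht0]
    have e1 : (Δ.resEnd (μ :: ν) x v : H) =
        cfc (fun t : ℂ => (x * t + μ)⁻¹) Δ.inv (Δ.resEnd ν x (Δ.cpow (-1) v)) := by
      rw [coe_resEnd, coe_resEnd, resProd_cons _ hν hx, resProd_singleton_apply _ hμ hx,
        cpow_neg_one, coe_restr, mul_assoc, ← hcomm.eq]
      rfl
    have e2 : Δ.cpow (-(μ :: ν).length) v = Δ.cpow (-ν.length) (Δ.cpow (-1) v) := by
      rw [← Module.End.mul_apply, ← cpow_add]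
      congr 2
      push_cast [List.length_cons]
      ring
    rw [e1, e2, mul_assoc]
    refine (ContinuousLinearMap.le_opNorm _ _).trans ?_
    exact mul_le_mul hg (h x hx _) (norm_nonneg _) (by positivity)

theorem resProd_singleton_apply_add {μ : ℝ} (hμ : 0 < μ) {x : ℝ} (hx : 0 < x) (v : Δ.smooth) :
    Δ.resProd [μ] x ((x : ℂ) • (v : H) + (μ : ℂ) • (Δ.op v : H)) = v := by
  have hn := Δ.isStarNormal_inv
  have hc : ContinuousOn (resSymbol [μ] x) (spectrum ℂ Δ.inv) :=
    Δ.continuousOn_resSymbol (by simpa using hμ) hx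
  have key : Δ.resProd [μ] x * ((x : ℂ) • Δ.inv + (μ : ℂ) • 1) = Δ.inv := by
    have e1 : (x : ℂ) • Δ.inv + (μ : ℂ) • (1 : H →L[ℂ] H) =
        cfc (fun t : ℂ => (x : ℂ) * t + μ) Δ.inv := by
      rw [cfc_add_const (μ : ℂ) (fun t : ℂ => (x : ℂ) * t) Δ.inv (by fun_prop) hn,
        cfc_const_mul_id (x : ℂ) Δ.inv hn, Algebra.algebraMap_eq_smul_one]
    rw [e1, resProd, ← cfc_mul _ _ _ hc (by fun_prop)]
    conv_rhs => rw [← cfc_id' ℂ Δ.inv]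
    refine cfc_congr fun t ht => ?_
    have := Δ.mul_add_ne_zero hx hμ ht
    simp only [resSymbol_cons, resSymbol_nil, mul_one]
    exact div_mul_cancel₀ _ this
  have h := congrArg (fun C : H →L[ℂ] H => C (Δ.op v)) key
  simp only [mul_apply_eq_comp, Δ.inv_op] at h
  refine Eq.trans (congrArg _ ?_) h
  simp [Δ.inv_op]

theorem smul_resEnd_add {μ : ℝ} (hμ : 0 < μ) {x : ℝ} (hx : 0 < x) (v : Δ.smooth) :
    (x : ℂ) • Δ.resEnd [μ] x v + (μ : ℂ) • Δ.op (Δ.resEnd [μ] x v) = v := by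
  have h : Δ.resEnd [μ] x ((x : ℂ) • v + (μ : ℂ) • Δ.op v) = v :=
    Subtype.ext (Δ.resProd_singleton_apply_add hμ hx v)
  have hc : Commute (Δ.resEnd [μ] x) Δ.op := Δ.restr_commute_op _ _
  have hc' := congrArg (fun L : Module.End ℂ Δ.smooth => L v) hc.eq
  simp only [Module.End.mul_apply] at hc'
  rwa [map_add, map_smul, map_smul, hc'] at h

theorem resEnd_cons {μ : ℝ} {ν : List ℝ} (hν : ∀ κ ∈ μ :: ν, 0 < κ) {x : ℝ} (hx : 0 < x) :
    Δ.resEnd (μ :: ν) x = Δ.resEnd [μ] x * Δ.resEnd ν x :=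
  LinearMap.ext fun v => Subtype.ext (by
    rw [coe_resEnd, resProd_cons _ hν hx]; rfl)

/-! ### Integrals of products of resolvents -/

theorem integrableOn_cpow_smul_resProd {a : ℂ} (ha0 : 0 < a.re) (ha1 : a.re < 1) {μ : ℝ}
    {ν : List ℝ} (hν : ∀ κ ∈ μ :: ν, 0 < κ) :
    IntegrableOn (fun x : ℝ => (x : ℂ) ^ (-a) • Δ.resProd (μ :: ν) x) (Ioi 0) := by
  obtain ⟨c, hc, h⟩ := Δ.exists_norm_resProd_cons_le hν
  refine Integrable.mono' ((integrableOn_rpow_mul_inv_add_one ha0 ha1).const_mul c)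
    (((continuousOn_ofReal_cpow _).smul (Δ.continuousOn_resProd hν)).aestronglyMeasurable
      measurableSet_Ioi) ?_
  filter_upwards [ae_restrict_mem measurableSet_Ioi] with x hx
  rw [norm_smul, norm_ofReal_cpow_neg hx, mul_left_comm]
  exact mul_le_mul_of_nonneg_left (h x hx) (Real.rpow_nonneg (le_of_lt hx) _)

theorem integral_cpow_smul_resProd {a : ℂ} (ha0 : 0 < a.re) (ha1 : a.re < 1) {μ : ℝ}
    {ν : List ℝ} (hν : ∀ κ ∈ μ :: ν, 0 < κ) :
    ∫ x in Ioi (0 : ℝ), (x : ℂ) ^ (-a) • Δ.resProd (μ :: ν) x =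
      stieltjes a (μ :: ν) • Δ.invCPow (a + ν.length) := by
  have hn := Δ.isStarNormal_inv
  obtain ⟨c, hc, h⟩ := Δ.exists_norm_resSymbol_cons_le hν
  have hpos : 0 < (a + ν.length).re := by
    rw [Complex.add_re, Complex.natCast_re]; positivity
  have h1 : ∫ x in Ioi (0 : ℝ), (x : ℂ) ^ (-a) • Δ.resProd (μ :: ν) x =
      ∫ x in Ioi (0 : ℝ), cfc (fun t => (x : ℂ) ^ (-a) * resSymbol (μ :: ν) x t) Δ.inv := by
    refine setIntegral_congr_fun measurableSet_Ioi fun x hx => ?_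
    exact (cfc_const_mul _ _ _ (Δ.continuousOn_resSymbol hν hx)).symm
  rw [h1, invCPow, ← cfc_const_mul _ _ _ (Δ.continuousOn_cpow_spectrum hpos),
    ← cfc_setIntegral measurableSet_Ioi (fun (x : ℝ) t => (x : ℂ) ^ (-a) * resSymbol (μ :: ν) x t)
      (fun x => c * (x ^ (-a.re) * (x + 1)⁻¹)) Δ.inv]
  · refine cfc_congr fun t ht => ?_
    obtain ⟨t, ht0, -, rfl⟩ := Δ.spectrum_inv ht
    -- The scaling formula needs `t > 0`; at `t = 0` both symbols vanish, because there is at least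
    -- one node and the exponent has positive real part.
    rcases ht0.eq_or_lt with rfl | ht0
    · have h0 : a + ν.length ≠ 0 := fun h0 => by rw [h0] at hpos; simp at hpos
      simp [resSymbol_cons, Complex.zero_cpow h0]
    · unfold resSymbol
      rw [integral_cpow_mul_prod _ ht0, List.length_cons]
      congr 2
      push_cast
      ring
  · refine ContinuousOn.mul ?_ (Δ.continuousOn_uncurry_resSymbol hν)
    exact (continuousOn_ofReal_cpow (-a)).comp continuousOn_fst fun q hq => hq.1
  · filter_upwards [ae_restrict_mem measurableSet_Ioi] with x hx t ht
    rw [norm_mul, norm_ofReal_cpow_neg hx, mul_left_comm]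
    exact mul_le_mul_of_nonneg_left (h x hx t ht) (Real.rpow_nonneg (le_of_lt hx) _)
  · exact ((integrableOn_rpow_mul_inv_add_one ha0 ha1).const_mul c).hasFiniteIntegral

/-- The integral of `x ^ (-a) (x + Δ)⁻¹ X ∏ (x + μ Δ)⁻¹ v` over `x > 0`. -/
def resIntegral (a : ℂ) (ν : List ℝ) (X : Module.End ℂ Δ.smooth) (v : Δ.smooth) : H :=
  ∫ x in Ioi (0 : ℝ), (x : ℂ) ^ (-a) • Δ.resProd [1] x (X (Δ.resEnd ν x v))

variable {X : Module.End ℂ Δ.smooth} {p : ℂ}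

/-- The factorisation `X = B Δ ^ p` with `B` bounded lets the possibly unbounded `X` pass through
limits and integrals of resolvents, since `Δ ^ p` commutes with these. -/
theorem exists_extension_of_bound {C : ℝ} (hX : ∀ v, ‖(X v : H)‖ ≤ C * ‖(Δ.cpow p v : H)‖) :
    ∃ B : H →L[ℂ] H, ∀ v : Δ.smooth, (X v : H) = B (Δ.cpow p v) := by
  obtain ⟨B, hB⟩ := Δ.exists_extension (Δ.smooth.subtype ∘ₗ X ∘ₗ Δ.cpow (-p)) C fun v => by
    have := hX (Δ.cpow (-p) v)
    rwa [← Module.End.mul_apply (Δ.cpow p), ← cpow_add, add_neg_cancel, cpow_zero] at this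
  refine ⟨B, fun v => ?_⟩
  rw [hB]
  simp only [LinearMap.comp_apply, Submodule.subtype_apply]
  rw [← Module.End.mul_apply (Δ.cpow (-p)), ← cpow_add, neg_add_cancel, cpow_zero]
  rfl

theorem resEnd_commute_cpow (ν : List ℝ) (x : ℝ) (z : ℂ) :
    Commute (Δ.resEnd ν x) (Δ.cpow z) := by
  rw [Δ.cpow_eq_restr_mul z _ (lt_floor_add_one z)]
  refine Commute.mul_right ?_ ((Δ.restr_commute_op _ _).pow_right _)
  exact LinearMap.ext fun v => Subtype.ext (congrArg (fun C : H →L[ℂ] H => C v)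
    (cfc_commute_cfc (R := ℂ) _ _ Δ.inv).eq)

theorem cpow_resEnd (ν : List ℝ) (x : ℝ) (z : ℂ) (v : Δ.smooth) :
    Δ.cpow z (Δ.resEnd ν x v) = Δ.resEnd ν x (Δ.cpow z v) :=
  (congrArg (fun L : Module.End ℂ Δ.smooth => L v) (Δ.resEnd_commute_cpow ν x z).eq).symm

theorem continuousOn_apply_resEnd {C : ℝ} (hX : ∀ v, ‖(X v : H)‖ ≤ C * ‖(Δ.cpow p v : H)‖)
    {ν : List ℝ} (hν : ∀ μ ∈ ν, 0 < μ) (v : Δ.smooth) :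
    ContinuousOn (fun x => (X (Δ.resEnd ν x v) : H)) (Ioi 0) := by
  obtain ⟨B, hB⟩ := Δ.exists_extension_of_bound hX
  have : (fun x => (X (Δ.resEnd ν x v) : H)) = fun x => B (Δ.resProd ν x (Δ.cpow p v)) := by
    ext x
    rw [hB, cpow_resEnd, coe_resEnd]
  rw [this]
  exact B.continuous.comp_continuousOn ((Δ.continuousOn_resProd hν).clm_apply continuousOn_const)

theorem one_singleton_pos : ∀ κ ∈ [(1 : ℝ)], 0 < κ := by simp

/-- The left resolvent is spent on decay in `x`, the right ones on lowering the order. The gain of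
`Δ ^ (-a)` is given up here and recovered in `hasExpansion_of_strip`. -/
theorem exists_norm_apply_resEnd_le {C : ℝ} (hX : ∀ v, ‖(X v : H)‖ ≤ C * ‖(Δ.cpow p v : H)‖)
    {ν : List ℝ} (hν : ∀ μ ∈ ν, 0 < μ) :
    ∃ c : ℝ, 0 ≤ c ∧ ∀ v : Δ.smooth, ∀ x : ℝ, 0 < x →
      ‖Δ.resProd [1] x (X (Δ.resEnd ν x v))‖ ≤
        c * ‖(Δ.cpow (p - ν.length) v : H)‖ * (x + 1)⁻¹ := by
  obtain ⟨c, hc, h⟩ := Δ.exists_norm_resEnd_le hν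
  obtain ⟨d, hd, h'⟩ := Δ.exists_norm_resProd_cons_le one_singleton_pos
  refine ⟨d * (|C| * c), by positivity, fun v x hx => ?_⟩
  have e : Δ.cpow (p - ν.length) v = Δ.cpow (-ν.length) (Δ.cpow p v) := by
    rw [← Module.End.mul_apply, ← cpow_add]
    congr 2
    ring
  calc ‖Δ.resProd [1] x (X (Δ.resEnd ν x v))‖
      ≤ ‖Δ.resProd [1] x‖ * ‖(X (Δ.resEnd ν x v) : H)‖ := ContinuousLinearMap.le_opNorm _ _
    _ ≤ (d * (x + 1)⁻¹) * (|C| * (c * ‖(Δ.cpow (p - ν.length) v : H)‖)) := by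
        refine mul_le_mul (h' x hx) ?_ (norm_nonneg _) (by positivity)
        refine (hX _).trans (mul_le_mul (le_abs_self C) ?_ (norm_nonneg _) (abs_nonneg _))
        rw [cpow_resEnd, e]
        exact h x hx _
    _ = _ := by ring

theorem integrableOn_resIntegral {C : ℝ} (hX : ∀ v, ‖(X v : H)‖ ≤ C * ‖(Δ.cpow p v : H)‖)
    {a : ℂ} (ha0 : 0 < a.re) (ha1 : a.re < 1) {ν : List ℝ} (hν : ∀ μ ∈ ν, 0 < μ) (v : Δ.smooth) :
    IntegrableOn (fun x : ℝ => (x : ℂ) ^ (-a) • Δ.resProd [1] x (X (Δ.resEnd ν x v))) (Ioi 0) := by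
  obtain ⟨c, hc, h⟩ := Δ.exists_norm_apply_resEnd_le hX hν
  refine Integrable.mono' ((integrableOn_rpow_mul_inv_add_one ha0 ha1).const_mul
    (c * ‖(Δ.cpow (p - ν.length) v : H)‖))
    (((continuousOn_ofReal_cpow _).smul ((Δ.continuousOn_resProd one_singleton_pos).clm_apply
      (Δ.continuousOn_apply_resEnd hX hν v))).aestronglyMeasurable measurableSet_Ioi) ?_
  filter_upwards [ae_restrict_mem measurableSet_Ioi] with x hx
  rw [norm_smul, norm_ofReal_cpow_neg hx, mul_left_comm]
  exact mul_le_mul_of_nonneg_left (h v x hx) (Real.rpow_nonneg (le_of_lt hx) _)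

theorem exists_norm_resIntegral_le {C : ℝ} (hX : ∀ v, ‖(X v : H)‖ ≤ C * ‖(Δ.cpow p v : H)‖)
    {a : ℂ} (ha0 : 0 < a.re) (ha1 : a.re < 1) {ν : List ℝ} (hν : ∀ μ ∈ ν, 0 < μ) :
    ∃ c : ℝ, ∀ v : Δ.smooth,
      ‖Δ.resIntegral a ν X v‖ ≤ c * ‖(Δ.cpow (p - ν.length) v : H)‖ := by
  obtain ⟨c, hc, h⟩ := Δ.exists_norm_apply_resEnd_le hX hν
  refine ⟨c * ∫ x in Ioi (0 : ℝ), x ^ (-a.re) * (x + 1)⁻¹, fun v => ?_⟩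
  rw [mul_right_comm, ← integral_const_mul]
  refine norm_integral_le_of_norm_le ((integrableOn_rpow_mul_inv_add_one ha0 ha1).const_mul _) ?_
  filter_upwards [ae_restrict_mem measurableSet_Ioi] with x hx
  rw [norm_smul, norm_ofReal_cpow_neg hx, mul_left_comm]
  exact mul_le_mul_of_nonneg_left (h v x hx) (Real.rpow_nonneg (le_of_lt hx) _)

theorem resIntegral_add {X' : Module.End ℂ Δ.smooth} {C C' : ℝ}
    (hX : ∀ v, ‖(X v : H)‖ ≤ C * ‖(Δ.cpow p v : H)‖)
    (hX' : ∀ v, ‖(X' v : H)‖ ≤ C' * ‖(Δ.cpow p v : H)‖)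
    {a : ℂ} (ha0 : 0 < a.re) (ha1 : a.re < 1) {ν : List ℝ} (hν : ∀ μ ∈ ν, 0 < μ) (v : Δ.smooth) :
    Δ.resIntegral a ν (X + X') v = Δ.resIntegral a ν X v + Δ.resIntegral a ν X' v := by
  rw [resIntegral, resIntegral, resIntegral, ← integral_add
    (Δ.integrableOn_resIntegral hX ha0 ha1 hν v) (Δ.integrableOn_resIntegral hX' ha0 ha1 hν v)]
  refine integral_congr_ae (Eventually.of_forall fun x => ?_)
  simp only [LinearMap.add_apply, Submodule.coe_add, map_add, smul_add]

theorem resIntegral_zero (a : ℂ) (ν : List ℝ) (v : Δ.smooth) : Δ.resIntegral a ν 0 v = 0 := by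
  simp [resIntegral]

/-- Integrals of `x ^ (-a) ∏ (x + μ Δ)⁻¹` are multiples of powers of `Δ`. -/
theorem integral_apply_resEnd {C : ℝ} (hX : ∀ v, ‖(X v : H)‖ ≤ C * ‖(Δ.cpow p v : H)‖)
    {a : ℂ} (ha0 : 0 < a.re) (ha1 : a.re < 1) {μ : ℝ} {ν : List ℝ} (hν : ∀ κ ∈ μ :: ν, 0 < κ)
    (v : Δ.smooth) :
    IntegrableOn (fun x : ℝ => (x : ℂ) ^ (-a) • (X (Δ.resEnd (μ :: ν) x v) : H)) (Ioi 0) ∧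
    ∫ x in Ioi (0 : ℝ), (x : ℂ) ^ (-a) • (X (Δ.resEnd (μ :: ν) x v) : H) =
      stieltjes a (μ :: ν) • (X (Δ.cpow (-a - ν.length) v) : H) := by
  obtain ⟨B, hB⟩ := Δ.exists_extension_of_bound hX
  let L : (H →L[ℂ] H) →L[ℂ] H := B ∘L ContinuousLinearMap.apply ℂ H (Δ.cpow p v : H)
  have hL : ∀ x : ℝ, (x : ℂ) ^ (-a) • (X (Δ.resEnd (μ :: ν) x v) : H) =
      L ((x : ℂ) ^ (-a) • Δ.resProd (μ :: ν) x) := fun x => by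
    rw [map_smul, hB, cpow_resEnd, coe_resEnd]
    rfl
  have hint := Δ.integrableOn_cpow_smul_resProd ha0 ha1 hν
  have hpos : 0 < (a + ν.length).re := by
    rw [Complex.add_re, Complex.natCast_re]; positivity
  simp only [hL]
  refine ⟨L.integrable_comp hint, ?_⟩
  rw [L.integral_comp_comm hint, integral_cpow_smul_resProd _ ha0 ha1 hν, map_smul, hB]
  congr 1
  have e : -a - (ν.length : ℂ) = -(a + ν.length) := by ring
  change B (Δ.invCPow (a + ν.length) (Δ.cpow p v)) = _
  rw [← coe_cpow_neg _ _ hpos, e, ← Module.End.mul_apply, ← Module.End.mul_apply, ← cpow_add,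
    ← cpow_add, add_comm]

/-- One commutation step under the integral: `(x + Δ)⁻¹ X = X (x + μ Δ)⁻¹ - (x + Δ)⁻¹ X' (x + μ
Δ)⁻¹`. The first part integrates to a power of `Δ`. -/
theorem resIntegral_eq_sub {X' : Module.End ℂ Δ.smooth} {p' : ℂ} {C C' : ℝ}
    (hX : ∀ v, ‖(X v : H)‖ ≤ C * ‖(Δ.cpow p v : H)‖)
    (hX' : ∀ v, ‖(X' v : H)‖ ≤ C' * ‖(Δ.cpow p' v : H)‖)
    {a : ℂ} (ha0 : 0 < a.re) (ha1 : a.re < 1) {μ : ℝ} {ν : List ℝ} (hν : ∀ κ ∈ μ :: ν, 0 < κ)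
    (hcomm : Δ.op * X = (μ : ℂ) • (X * Δ.op) + X') (v : Δ.smooth) :
    Δ.resIntegral a ν X v = stieltjes a (μ :: ν) • (X (Δ.cpow (-a - ν.length) v) : H) -
      Δ.resIntegral a (μ :: ν) X' v := by
  obtain ⟨h1, h2⟩ := Δ.integral_apply_resEnd hX ha0 ha1 hν v
  rw [← h2, resIntegral, resIntegral, ← integral_sub h1
    (Δ.integrableOn_resIntegral hX' ha0 ha1 hν v)]
  refine setIntegral_congr_fun measurableSet_Ioi fun x hx => ?_
  have hμ := hν μ List.mem_cons_self
  rw [← smul_sub]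
  congr 1
  set u := Δ.resEnd (μ :: ν) x v with hu
  -- In terms of `u`, which includes the new resolvent, the old argument is `(x + μ Δ) u`, so `X`
  -- can be moved across `x + μ Δ`.
  have hw : Δ.resEnd ν x v = (x : ℂ) • u + (μ : ℂ) • Δ.op u := by
    have := Δ.smul_resEnd_add hμ hx (Δ.resEnd ν x v)
    rw [← Module.End.mul_apply, ← resEnd_cons _ hν hx, ← hu] at this
    exact this.symm
  have hc := congrArg (fun L : Module.End ℂ Δ.smooth => L u) hcomm
  simp only [Module.End.mul_apply, LinearMap.add_apply, LinearMap.smul_apply] at hc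
  have e : X (Δ.resEnd ν x v) = (x : ℂ) • X u + ((1 : ℝ) : ℂ) • Δ.op (X u) - X' u := by
    rw [hw, map_add, map_smul, map_smul, hc, Complex.ofReal_one, one_smul]
    abel
  rw [e, Submodule.coe_sub, map_sub]
  congr 1
  exact Δ.resProd_singleton_apply_add zero_lt_one hx (X u)

theorem resIntegral_nil (X : Module.End ℂ Δ.smooth)
    {a : ℂ} (ha0 : 0 < a.re) (ha1 : a.re < 1) (v : Δ.smooth) :
    Δ.resIntegral a [] X v = stieltjes a [1] • (Δ.cpow (-a) (X v) : H) := by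
  have h1 : ∀ w : Δ.smooth, ‖((1 : Module.End ℂ Δ.smooth) w : H)‖ ≤ 1 * ‖(Δ.cpow 0 w : H)‖ :=
    fun w => by rw [cpow_zero, one_mul]
  have := (Δ.integral_apply_resEnd h1 ha0 ha1 one_singleton_pos (X v)).2
  rw [List.length_nil, Nat.cast_zero, sub_zero] at this
  rw [Module.End.one_apply] at this
  rw [← this, resIntegral]
  refine integral_congr_ae (Eventually.of_forall fun x => ?_)
  have e : Δ.resEnd [] x v = v := Subtype.ext (by rw [coe_resEnd, resProd_nil]; rfl)
  dsimp only
  rw [e]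
  rfl

end AbstractLaplace

namespace AbstractLaplace

variable {H : Type*} [NormedAddCommGroup H] [InnerProductSpace ℂ H] [CompleteSpace H]
variable (Δ : AbstractLaplace H)

/-! ### Operators bounded relative to a power of `Δ` -/

/-- The operator `T` is bounded by a multiple of `Δ ^ q`. -/
def BoundedBy (T : Module.End ℂ Δ.smooth) (q : ℂ) : Prop :=
  ∃ C : ℝ, 0 ≤ C ∧ ∀ v : Δ.smooth, ‖(T v : H)‖ ≤ C * ‖(Δ.cpow q v : H)‖

variable {Δ} {S T : Module.End ℂ Δ.smooth} {p q : ℂ}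

theorem BoundedBy.of_bound {C : ℝ} (h : ∀ v : Δ.smooth, ‖(T v : H)‖ ≤ C * ‖(Δ.cpow q v : H)‖) :
    Δ.BoundedBy T q :=
  ⟨|C|, abs_nonneg C, fun v => (h v).trans
    (mul_le_mul_of_nonneg_right (le_abs_self C) (norm_nonneg _))⟩

theorem BoundedBy.zero (q : ℂ) : Δ.BoundedBy 0 q := ⟨0, le_rfl, fun v => by simp⟩

theorem BoundedBy.add (hS : Δ.BoundedBy S q) (hT : Δ.BoundedBy T q) : Δ.BoundedBy (S + T) q := by
  obtain ⟨C, hC, h⟩ := hS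
  obtain ⟨D, hD, h'⟩ := hT
  refine ⟨C + D, by positivity, fun v => ?_⟩
  rw [LinearMap.add_apply, Submodule.coe_add, add_mul]
  exact (norm_add_le _ _).trans (add_le_add (h v) (h' v))

theorem BoundedBy.neg (hT : Δ.BoundedBy T q) : Δ.BoundedBy (-T) q := by
  obtain ⟨C, hC, h⟩ := hT
  exact ⟨C, hC, fun v => by rw [LinearMap.neg_apply, Submodule.coe_neg, norm_neg]; exact h v⟩

theorem BoundedBy.sub (hS : Δ.BoundedBy S q) (hT : Δ.BoundedBy T q) : Δ.BoundedBy (S - T) q := by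
  rw [sub_eq_add_neg]
  exact hS.add hT.neg

theorem BoundedBy.sum {ι : Type*} {s : Finset ι} {f : ι → Module.End ℂ Δ.smooth}
    (h : ∀ i ∈ s, Δ.BoundedBy (f i) q) : Δ.BoundedBy (∑ i ∈ s, f i) q :=
  Finset.sum_induction f (Δ.BoundedBy · q) (fun _ _ => BoundedBy.add) (BoundedBy.zero q) h

theorem BoundedBy.mono (hT : Δ.BoundedBy T p) (h : p.re ≤ q.re) : Δ.BoundedBy T q := by
  obtain ⟨C, hC, hT⟩ := hT
  obtain ⟨D, hD, h'⟩ := Δ.exists_norm_cpow_le h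
  refine ⟨C * D, by positivity, fun v => (hT v).trans ?_⟩
  rw [mul_assoc]
  exact mul_le_mul_of_nonneg_left (h' v) hC

theorem BoundedBy.mul_cpow (hT : Δ.BoundedBy T q) (z : ℂ) :
    Δ.BoundedBy (T * Δ.cpow z) (q + z) := by
  obtain ⟨C, hC, h⟩ := hT
  refine ⟨C, hC, fun v => ?_⟩
  rw [cpow_add]
  exact h _

theorem BoundedBy.cpow_mul (hT : Δ.BoundedBy T q) {z : ℂ} (hz : z.re ≤ 0) :
    Δ.BoundedBy (Δ.cpow z * T) q := by
  obtain ⟨C, hC, hT⟩ := hT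
  obtain ⟨D, hD, h⟩ := Δ.exists_norm_cpow_le (p := z) (q := 0) (by simpa using hz)
  refine ⟨D * C, by positivity, fun v => ?_⟩
  have := h (T v)
  rw [cpow_zero] at this
  rw [mul_assoc]
  exact this.trans (mul_le_mul_of_nonneg_left (hT v) hD)

/-- Reduces Sobolev bounds to bounds into `H`, at the cost of a power of `Δ` on the left. -/
theorem mem_Op_of_boundedBy {r : ℕ} {t : ℝ}
    (h : ∀ s : ℝ, Δ.BoundedBy (Δ.cpow (((s - t : ℝ) : ℂ) / r) * T) ((s : ℂ) / r)) :
    T ∈ Δ.Op r t := fun s => by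
  obtain ⟨C, -, hC⟩ := h s
  exact ⟨C, hC⟩

theorem boundedBy_of_mem_Op {r : ℕ} {t : ℝ} (h : T ∈ Δ.Op r t) (s : ℝ) :
    Δ.BoundedBy (Δ.cpow (((s - t : ℝ) : ℂ) / r) * T) ((s : ℂ) / r) := by
  obtain ⟨C, hC⟩ := h s
  exact BoundedBy.of_bound hC

theorem sub_mem_Op {r : ℕ} {t : ℝ} (hS : S ∈ Δ.Op r t) (hT : T ∈ Δ.Op r t) :
    S - T ∈ Δ.Op r t := by
  refine mem_Op_of_boundedBy fun s => ?_
  rw [mul_sub]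
  exact (boundedBy_of_mem_Op hS s).sub (boundedBy_of_mem_Op hT s)

theorem Op_mono {r : ℕ} {t u : ℝ} (h : t ≤ u) : Δ.Op r t ⊆ Δ.Op r u := fun T hT => by
  refine mem_Op_of_boundedBy fun s => ?_
  have e : ((s - u : ℝ) : ℂ) / r = ((t - u : ℝ) : ℂ) / r + ((s - t : ℝ) : ℂ) / r := by
    push_cast; ring
  rw [e, cpow_add, mul_assoc]
  refine (boundedBy_of_mem_Op hT s).cpow_mul ?_
  rw [← Complex.ofReal_natCast, ← Complex.ofReal_div, Complex.ofReal_re]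
  exact div_nonpos_of_nonpos_of_nonneg (by linarith) (Nat.cast_nonneg r)

end AbstractLaplace

/-! ### Orders of the terms and of the remainders -/

namespace TwistedDOAlgebra

variable {H : Type*} [NormedAddCommGroup H] [InnerProductSpace ℂ H] [CompleteSpace H]
variable {Δ : AbstractLaplace H} {r : ℕ} {𝒟 : TwistedDOAlgebra Δ r}

theorem boundedBy_toEnd {m : ℕ} {X : 𝒟.Alg} (hX : 𝒟.toEnd X ∈ 𝒟.filt m) :
    Δ.BoundedBy (𝒟.toEnd X) ((m : ℂ) / r) := by
  obtain ⟨C, hC, h⟩ := 𝒟.elliptic m _ hX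
  exact ⟨C, hC.le, h⟩

variable (hdiag : IsDiagonalizable 𝒟.θ) (hpos : HasPositiveEigenvalues 𝒟.θ)

include hpos in
theorem boundedBy_coeffMap_mul_cpow (hr : r ≠ 0) (k : ℕ) (f : ℂ → ℂ) (z : ℂ) {m : ℕ} {Y : 𝒟.Alg}
    (hY : 𝒟.toEnd Y ∈ 𝒟.filt m) :
    Δ.BoundedBy (𝒟.toEnd (𝒟.coeffMap hdiag k f Y) * Δ.cpow (z - k)) (z + ((m : ℂ) - k) / r) := by
  have h := (boundedBy_toEnd (coeffMap_mem hdiag hpos k f hY)).mul_cpow (z - k)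
  have hr' : (r : ℂ) ≠ 0 := Nat.cast_ne_zero.2 hr
  convert h using 1
  rw [Nat.cast_add, Nat.cast_mul, Nat.cast_sub (Nat.one_le_iff_ne_zero.2 hr)]
  field_simp
  push_cast
  ring

include hpos in
-- Generalised over the node list `ν` and the function `f` for the induction: a commutation step
-- prepends the weight `μ` to `ν`, replaces `f` by `dslope f μ`, `Y` by `∇Y` and `c` by `-c`.
theorem exists_norm_resIntegral_sub_le (hr : r ≠ 0) {a : ℂ} (ha0 : 0 < a.re) (ha1 : a.re < 1)
    (n : ℕ) {ν : List ℝ} (hν : ∀ κ ∈ ν, 0 < κ) {f : ℂ → ℂ}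
    (hf : DifferentiableOn ℂ f rightHalfPlane) {c : ℂ}
    (hfs : ∀ s : ℝ, 0 < s → f s = c * stieltjes a (s :: ν)) {m : ℕ} {Y : 𝒟.Alg}
    (hY : 𝒟.toEnd Y ∈ 𝒟.filt m) :
    ∃ C : ℝ, ∀ v : Δ.smooth, ‖c • Δ.resIntegral a ν (𝒟.toEnd Y) v -
      ∑ k ∈ Finset.range n,
        (𝒟.toEnd (𝒟.coeffMap hdiag k f Y) (Δ.cpow (-a - ν.length - k) v) : H)‖ ≤
      C * ‖(Δ.cpow (((m : ℂ) - n) / r - ν.length) v : H)‖ := by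
  induction n generalizing ν f c m Y with
  | zero =>
    obtain ⟨C, -, hC⟩ := boundedBy_toEnd hY
    obtain ⟨D, hD⟩ := Δ.exists_norm_resIntegral_le hC ha0 ha1 hν
    refine ⟨‖c‖ * D, fun v => ?_⟩
    rw [Finset.sum_range_zero, sub_zero, norm_smul, mul_assoc, Nat.cast_zero, sub_zero]
    exact mul_le_mul_of_nonneg_left (hD v) (norm_nonneg c)
  | succ n ih =>
    -- Membership in `𝒟^m` is carried along because additivity of the integral needs an elliptic
    -- bound for each summand.
    refine (weight_induction hdiag hpos (P := fun Y => 𝒟.toEnd Y ∈ 𝒟.filt m ∧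
      ∃ C : ℝ, ∀ v : Δ.smooth, ‖c • Δ.resIntegral a ν (𝒟.toEnd Y) v -
        ∑ k ∈ Finset.range (n + 1),
          (𝒟.toEnd (𝒟.coeffMap hdiag k f Y) (Δ.cpow (-a - ν.length - k) v) : H)‖ ≤
        C * ‖(Δ.cpow (((m : ℂ) - (n + 1 : ℕ)) / r - ν.length) v : H)‖) ?_ ?_ ?_ hY).2
    · refine ⟨by rw [map_zero]; exact Submodule.zero_mem _, 0, fun v => ?_⟩
      simp [AbstractLaplace.resIntegral_zero]
    · rintro X Y ⟨hX, C, hC⟩ ⟨hY, D, hD⟩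
      refine ⟨by rw [map_add]; exact Submodule.add_mem _ hX hY, C + D, fun v => ?_⟩
      obtain ⟨CX, -, hCX⟩ := boundedBy_toEnd hX
      obtain ⟨CY, -, hCY⟩ := boundedBy_toEnd hY
      rw [map_add, Δ.resIntegral_add hCX hCY ha0 ha1 hν, smul_add, add_mul]
      simp only [map_add, LinearMap.add_apply, Submodule.coe_add]
      rw [Finset.sum_add_distrib, add_sub_add_comm]
      exact (norm_add_le _ _).trans (add_le_add (hC v) (hD v))
    · intro μ hμ _ X hX hXμ
      refine ⟨hX, ?_⟩
      have hν' : ∀ κ ∈ μ :: ν, 0 < κ := by simpa [hμ] using hν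
      have hμU := ofReal_mem_rightHalfPlane hμ
      obtain ⟨C, hC⟩ := ih hν' (differentiableOn_dslope_rightHalfPlane hf hμU)
        (fun s hs => dslope_eq_stieltjes ha0 ha1 hμ hν hf hfs hs) (𝒟.nabla_mem hX)
      refine ⟨C, fun v => ?_⟩
      obtain ⟨CX, -, hCX⟩ := boundedBy_toEnd hX
      obtain ⟨CY, -, hCY⟩ := boundedBy_toEnd (𝒟.nabla_mem hX)
      have hcomm : Δ.op * 𝒟.toEnd X =
          (μ : ℂ) • (𝒟.toEnd X * Δ.op) + 𝒟.toEnd (𝒟.nabla X) := by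
        rw [toEnd_nabla, Module.End.mem_eigenspace_iff.1 hXμ, map_smul, smul_mul_assoc]
        abel
      rw [Δ.resIntegral_eq_sub hCX hCY ha0 ha1 hν' hcomm, Finset.sum_range_succ']
      -- The order balances: `∇` adds `r - 1`, and the new resolvent removes `r`, which is the
      -- single order gained by one more term.
      have e1 : ((m : ℂ) - (n + 1 : ℕ)) / r - ν.length =
          (((m + (r - 1) : ℕ) : ℂ) - n) / r - (μ :: ν).length := by
        have hr' : (r : ℂ) ≠ 0 := Nat.cast_ne_zero.2 hr
        rw [Nat.cast_add m, Nat.cast_sub (Nat.one_le_iff_ne_zero.2 hr), List.length_cons]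
        push_cast
        field_simp
        ring
      have e2 : ∀ k : ℕ, 𝒟.toEnd (𝒟.coeffMap hdiag (k + 1) f X)
          (Δ.cpow (-a - ν.length - (k + 1 : ℕ)) v) =
          𝒟.toEnd (𝒟.coeffMap hdiag k (dslope f μ) (𝒟.nabla X))
            (Δ.cpow (-a - (μ :: ν).length - k) v) := by
        intro k
        rw [coeffMap_succ_apply hdiag k f hXμ, List.length_cons]
        congr 3
        push_cast
        ring
      have e3 : (𝒟.toEnd (𝒟.coeffMap hdiag 0 f X) (Δ.cpow (-a - ν.length - (0 : ℕ)) v) : H) =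
          (c * stieltjes a (μ :: ν)) • (𝒟.toEnd X (Δ.cpow (-a - ν.length) v) : H) := by
        rw [coeffMap_zero_apply hdiag f hXμ, hfs μ hμ, map_smul, Nat.cast_zero, sub_zero]
        rfl
      rw [e1, e3]
      simp only [e2]
      refine le_trans (le_of_eq ?_) (hC v)
      congr 1
      rw [smul_sub, smul_smul, neg_smul]
      abel

/-- The difference of `Δ ^ z Y` and the first `n` terms of its expansion. -/
def remainder (z : ℂ) (n : ℕ) (Y : 𝒟.Alg) : Module.End ℂ Δ.smooth :=
  Δ.cpow z * 𝒟.toEnd Y -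
    ∑ k ∈ Finset.range n, 𝒟.toEnd (𝒟.coeffMap hdiag k (fun s => s ^ z) Y) * Δ.cpow (z - k)

theorem remainder_succ (z : ℂ) (n : ℕ) (Y : 𝒟.Alg) :
    remainder hdiag z n Y = remainder hdiag z (n + 1) Y +
      𝒟.toEnd (𝒟.coeffMap hdiag n (fun s => s ^ z) Y) * Δ.cpow (z - n) := by
  rw [remainder, remainder, Finset.sum_range_succ]
  abel

/-- The remainders of the expansion of `Δ ^ z Y` have the expected order as operators into `H`. -/
def HasExpansion (z : ℂ) : Prop :=
  ∀ (m : ℕ) (Y : 𝒟.Alg), 𝒟.toEnd Y ∈ 𝒟.filt m → ∀ n : ℕ,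
    Δ.BoundedBy (remainder hdiag z n Y) (z + ((m : ℂ) - n) / r)

theorem re_add_div (z : ℂ) (m n : ℕ) :
    (z + ((m : ℂ) - n) / r).re = z.re + ((m : ℝ) - n) / r := by
  rw [Complex.add_re, ← Complex.ofReal_natCast r, Complex.div_ofReal_re, Complex.sub_re,
    Complex.natCast_re, Complex.natCast_re]

include hpos in
-- A crude estimate after more terms suffices, because the extra terms themselves have the order
-- wanted for `n`. Every loss of order below is repaired this way.
theorem boundedBy_remainder_of_le (hr : r ≠ 0) (z : ℂ) {m n n' : ℕ} (hn : n ≤ n') {Y : 𝒟.Alg}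
    (hY : 𝒟.toEnd Y ∈ 𝒟.filt m)
    (h : Δ.BoundedBy (remainder hdiag z n' Y) (z + ((m : ℂ) - n) / r)) :
    Δ.BoundedBy (remainder hdiag z n Y) (z + ((m : ℂ) - n) / r) := by
  induction n', hn using Nat.le_induction with
  | base => exact h
  | succ k hk ih =>
    refine ih ?_
    rw [remainder_succ]
    refine h.add ((boundedBy_coeffMap_mul_cpow hdiag hpos hr k _ z hY).mono ?_)
    rw [re_add_div, re_add_div]
    gcongr

include hpos in
theorem hasExpansion_of_strip (hr : r ≠ 0) {a : ℂ} (ha0 : 0 < a.re) (ha1 : a.re < 1) :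
    HasExpansion hdiag (-a) := by
  intro m Y hY n
  -- The integral estimate misses the factor `Δ ^ (-a)`. As `Re a < 1`, expanding `r` further terms,
  -- worth one power of `Δ`, compensates.
  refine boundedBy_remainder_of_le hdiag hpos hr (-a) (Nat.le_add_right n r) hY ?_
  have hc := stieltjes_one_ne_zero ha0 ha1
  -- With no nodes the integral is `stieltjes a [1]` times `Δ ^ (-a) Y`; taking `c` to be the
  -- inverse makes the symbol exactly `s ^ (-a)`.
  obtain ⟨C, hC⟩ := exists_norm_resIntegral_sub_le hdiag hpos hr ha0 ha1 (n + r) (ν := [])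
    (by simp) (differentiableOn_cpow_rightHalfPlane (-a)) (c := (stieltjes a [1])⁻¹)
    (fun s hs => by
      rw [stieltjes_singleton hs, inv_mul_cancel_left₀ hc]) hY
  have h1 : Δ.BoundedBy (remainder hdiag (-a) (n + r) Y) (((m : ℂ) - (n + r : ℕ)) / r) := by
    refine AbstractLaplace.BoundedBy.of_bound (C := C) fun v => ?_
    have h2 := hC v
    rw [Δ.resIntegral_nil _ ha0 ha1, smul_smul, inv_mul_cancel₀ hc, one_smul, List.length_nil,
      Nat.cast_zero, sub_zero, sub_zero] at h2
    refine le_trans (le_of_eq ?_) h2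
    congr 1
    rw [remainder, LinearMap.sub_apply, Submodule.coe_sub, LinearMap.sum_apply,
      Submodule.coe_sum]
    rfl
  refine h1.mono ?_
  have hr' : (r : ℝ) ≠ 0 := Nat.cast_ne_zero.2 hr
  have h3 := re_add_div (r := r) 0 m (n + r)
  rw [zero_add, Complex.zero_re, zero_add] at h3
  rw [h3, re_add_div, Complex.neg_re]
  push_cast
  have : ((m : ℝ) - (n + r)) / r = (m - n) / r - 1 := by field_simp; ring
  rw [this]
  linarith

include hpos in
theorem remainder_one_add_two (n : ℕ) (Y : 𝒟.Alg) : remainder hdiag 1 (n + 2) Y = 0 := by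
  have e : (fun s : ℂ => s ^ (1 : ℂ)) = fun s => s := funext Complex.cpow_one
  rw [remainder, e, Finset.sum_range_succ', Finset.sum_range_succ']
  simp only [add_assoc, Nat.reduceAdd, coeffMap_id_add_two hdiag hpos]
  rw [coeffMap_id_one hdiag hpos, coeffMap_id_zero hdiag hpos, nablaLin_apply,
    toEnd_nabla, Nat.cast_one, sub_self, Nat.cast_zero, sub_zero, AbstractLaplace.cpow_zero,
    AbstractLaplace.cpow_one]
  simp

include hpos in
-- Expand `Δ ^ w Y` to `n` terms, then expand `Δ ^ z` against the `i`-th coefficient to `n - i`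
-- terms. By the Leibniz rule the resulting triangular double sum is the expansion for `z + w`. The
-- identity is exact.
theorem remainder_add (z w : ℂ) (n : ℕ) (Y : 𝒟.Alg) :
    remainder hdiag (z + w) n Y = Δ.cpow z * remainder hdiag w n Y +
      ∑ i ∈ Finset.range n,
        remainder hdiag z (n - i) (𝒟.coeffMap hdiag i (fun s => s ^ w) Y) * Δ.cpow (w - i) := by
  have hmul : ∀ l, 𝒟.coeffMap hdiag l (fun s => s ^ (z + w)) Y =
      ∑ i ∈ Finset.range (l + 1), 𝒟.coeffMap hdiag (l - i) (fun s => s ^ z)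
        (𝒟.coeffMap hdiag i (fun s => s ^ w) Y) := by
    intro l
    have := coeffMap_mul hdiag hpos l (differentiableOn_cpow_rightHalfPlane w)
      (differentiableOn_cpow_rightHalfPlane z)
    rw [coeffMap_congr hdiag hpos l
      (f := fun s => s ^ (z + w)) (g := (fun s : ℂ => s ^ w) * fun s : ℂ => s ^ z), this]
    · simp only [LinearMap.sum_apply, LinearMap.comp_apply]
    · intro s hs
      have h0 : s ≠ 0 := by rintro rfl; simp [rightHalfPlane] at hs
      simp only [Pi.mul_apply]
      rw [add_comm, Complex.cpow_add _ _ h0]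
  have hflip := Finset.sum_range_diag_flip n fun i k =>
    𝒟.toEnd (𝒟.coeffMap hdiag k (fun s => s ^ z) (𝒟.coeffMap hdiag i (fun s => s ^ w) Y)) *
      Δ.cpow (z - k) * Δ.cpow (w - i)
  have hl : ∑ l ∈ Finset.range n, 𝒟.toEnd (𝒟.coeffMap hdiag l (fun s => s ^ (z + w)) Y) *
      Δ.cpow (z + w - l) = ∑ i ∈ Finset.range n, ∑ k ∈ Finset.range (n - i),
        𝒟.toEnd (𝒟.coeffMap hdiag k (fun s => s ^ z) (𝒟.coeffMap hdiag i (fun s => s ^ w) Y)) *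
          Δ.cpow (z - k) * Δ.cpow (w - i) := by
    rw [← hflip]
    refine Finset.sum_congr rfl fun l _ => ?_
    rw [hmul, map_sum, Finset.sum_mul]
    refine Finset.sum_congr rfl fun i hi => ?_
    rw [mul_assoc, ← AbstractLaplace.cpow_add,
      Nat.cast_sub (Nat.lt_succ_iff.1 (Finset.mem_range.1 hi))]
    congr 2
    ring
  have hr : ∀ i, remainder hdiag z (n - i) (𝒟.coeffMap hdiag i (fun s => s ^ w) Y) *
      Δ.cpow (w - i) =
      Δ.cpow z * (𝒟.toEnd (𝒟.coeffMap hdiag i (fun s => s ^ w) Y) * Δ.cpow (w - i)) -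
        ∑ k ∈ Finset.range (n - i),
        𝒟.toEnd (𝒟.coeffMap hdiag k (fun s => s ^ z) (𝒟.coeffMap hdiag i (fun s => s ^ w) Y)) *
          Δ.cpow (z - k) * Δ.cpow (w - i) := by
    intro i
    rw [remainder, sub_mul, Finset.sum_mul, mul_assoc]
  simp only [hr]
  rw [Finset.sum_sub_distrib, ← hl, remainder, remainder, mul_sub, Finset.mul_sum,
    AbstractLaplace.cpow_add, mul_assoc]
  abel

variable {hdiag}

include hpos in
/-- The second part of `remainder_add` has the expected order. -/
theorem HasExpansion.boundedBy_sum (hr : r ≠ 0) {z : ℂ} (hz : HasExpansion hdiag z) (w : ℂ)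
    {m : ℕ} {Y : 𝒟.Alg} (hY : 𝒟.toEnd Y ∈ 𝒟.filt m) (n : ℕ) :
    Δ.BoundedBy (∑ i ∈ Finset.range n,
      remainder hdiag z (n - i) (𝒟.coeffMap hdiag i (fun s => s ^ w) Y) * Δ.cpow (w - i))
      (z + w + ((m : ℂ) - n) / r) := by
  refine AbstractLaplace.BoundedBy.sum fun i hi => ?_
  have h := (hz _ _ (coeffMap_mem hdiag hpos i (fun s => s ^ w) hY) (n - i)).mul_cpow (w - i)
  have hr' : (r : ℂ) ≠ 0 := Nat.cast_ne_zero.2 hr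
  convert h using 1
  rw [Nat.cast_add m, Nat.cast_mul, Nat.cast_sub (Nat.one_le_iff_ne_zero.2 hr),
    Nat.cast_sub (Finset.mem_range.1 hi).le]
  field_simp
  push_cast
  ring

include hpos in
-- A remainder for `w` bounded into `H` stays bounded after `Δ ^ z` only if `Re z ≤ 0`, and nothing
-- is gained from that factor; `N * r` extra terms make up for the missing `-Re z`.
theorem HasExpansion.add (hr : r ≠ 0) {z w : ℂ} (hz : HasExpansion hdiag z)
    (hw : HasExpansion hdiag w) (hz0 : z.re ≤ 0) : HasExpansion hdiag (z + w) := by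
  intro m Y hY n
  let N := ⌈-z.re⌉₊
  refine boundedBy_remainder_of_le hdiag hpos hr (z + w) (Nat.le_add_right n (N * r)) hY ?_
  rw [remainder_add hdiag hpos]
  have hr' : (0 : ℝ) < r := Nat.cast_pos.2 (Nat.pos_of_ne_zero hr)
  refine AbstractLaplace.BoundedBy.add ?_
    ((hz.boundedBy_sum hpos hr w hY (n + N * r)).mono ?_)
  · refine ((hw m Y hY (n + N * r)).cpow_mul hz0).mono ?_
    rw [re_add_div, re_add_div, Complex.add_re]
    have h1 : -z.re ≤ N := Nat.le_ceil _
    have h2 : ((m : ℝ) - (n + N * r : ℕ)) / r = (m - n) / r - N := by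
      push_cast; field_simp; ring
    rw [h2]
    linarith
  · rw [re_add_div, re_add_div]
    gcongr
    exact Nat.le_add_right _ _

include hpos in
theorem HasExpansion.add_one (hr : r ≠ 0) {z : ℂ} (hz : HasExpansion hdiag z) :
    HasExpansion hdiag (z + 1) := by
  intro m Y hY n
  -- With at least two terms the remainder for the exponent `1` is zero, so `Δ ^ z` is never applied
  -- on the left and no sign condition on `Re z` is needed.
  refine boundedBy_remainder_of_le hdiag hpos hr (z + 1) (Nat.le_add_right n 2) hY ?_
  rw [remainder_add hdiag hpos, remainder_one_add_two hdiag hpos, mul_zero, zero_add]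
  refine (hz.boundedBy_sum hpos hr 1 hY (n + 2)).mono ?_
  rw [re_add_div, re_add_div]
  gcongr
  exact Nat.le_add_right _ _

variable (hdiag)

include hpos in
-- For `N > -Re z` the exponent `z / N` lies in the strip `-1 < Re < 0`, and `z` is its `N`-fold
-- sum.
theorem hasExpansion_of_re_neg (hr : r ≠ 0) {z : ℂ} (hz : z.re < 0) : HasExpansion hdiag z := by
  let N := ⌊-z.re⌋₊ + 1
  have hN : -z.re < N := by exact_mod_cast Nat.lt_floor_add_one (-z.re)
  have hN0 : (0 : ℝ) < N := by linarith
  have hre : (-z / N).re = -z.re / N := by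
    rw [← Complex.ofReal_natCast, Complex.div_ofReal_re, Complex.neg_re]
  have h1 : HasExpansion hdiag (-(-z / N)) := by
    refine hasExpansion_of_strip hdiag hpos hr ?_ ?_
    · rw [hre]; exact div_pos (by linarith) hN0
    · rw [hre, div_lt_one hN0]; exact hN
  have h2 : ∀ k : ℕ, HasExpansion hdiag ((k + 1 : ℕ) * -(-z / N)) := by
    intro k
    induction k with
    | zero => simpa using h1
    | succ k ih =>
      have h3 := h1.add hpos hr ih (by
        rw [Complex.neg_re, hre]
        exact neg_nonpos.2 (div_nonneg (by linarith) hN0.le))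
      convert h3 using 1
      push_cast
      ring
  have h4 := h2 (N - 1)
  have hN' : (N : ℂ) ≠ 0 := by exact_mod_cast hN0.ne'
  have hN1 : N - 1 + 1 = N := Nat.succ_pred_eq_of_pos (by exact_mod_cast hN0)
  rw [hN1] at h4
  convert h4 using 1
  field_simp

include hpos in
theorem hasExpansion (hr : r ≠ 0) (z : ℂ) : HasExpansion hdiag z := by
  have h : ∀ (j : ℕ) (z : ℂ), z.re < j → HasExpansion hdiag z := by
    intro j
    induction j with
    | zero => exact fun z hz => hasExpansion_of_re_neg hdiag hpos hr (by simpa using hz)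
    | succ j ih =>
      intro z hz
      have := (ih (z - 1) (by push_cast at hz; simp; linarith)).add_one hpos hr
      rwa [sub_add_cancel] at this
  exact h (⌊z.re⌋₊ + 1) z (AbstractLaplace.lt_floor_add_one z)

include hpos in
-- Solving `remainder_add` for `Δ ^ w` times the remainder leaves only quantities already bounded
-- into `H`; `w` has either sign, which is why the expansion is needed for every exponent.
theorem remainder_mem_Op (hr : r ≠ 0) (z : ℂ) (n : ℕ) {m : ℕ} {Y : 𝒟.Alg}
    (hY : 𝒟.toEnd Y ∈ 𝒟.filt m) : remainder hdiag z n Y ∈ Δ.Op r (r * z.re + m - n) := by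
  have hr' : (r : ℝ) ≠ 0 := Nat.cast_ne_zero.2 hr
  refine AbstractLaplace.mem_Op_of_boundedBy fun s => ?_
  set w : ℂ := ((s - (r * z.re + m - n) : ℝ) : ℂ) / r with hw
  have e : Δ.cpow w * remainder hdiag z n Y = remainder hdiag (w + z) n Y -
      ∑ i ∈ Finset.range n,
        remainder hdiag w (n - i) (𝒟.coeffMap hdiag i (fun s => s ^ z) Y) * Δ.cpow (z - i) := by
    rw [remainder_add hdiag hpos, add_sub_cancel_right]
  rw [e]
  refine ((hasExpansion hdiag hpos hr (w + z) m Y hY n).sub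
    ((hasExpansion hdiag hpos hr w).boundedBy_sum hpos hr z hY n)).mono ?_
  rw [re_add_div, Complex.add_re, hw, ← Complex.ofReal_natCast r, ← Complex.ofReal_div,
    ← Complex.ofReal_div, Complex.ofReal_re, Complex.ofReal_re]
  refine le_of_eq ?_
  field_simp
  ring

end TwistedDOAlgebra

end

/-! ### The expansion theorem -/

theorem mainTheorem2 {H : Type*} [NormedAddCommGroup H] [InnerProductSpace ℂ H] [CompleteSpace H]
    (Δ : AbstractLaplace H) (r : ℕ) (hr : 2 ≤ r) (𝒟 : TwistedDOAlgebra Δ r)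
    (hdiag : IsDiagonalizable 𝒟.θ) (hpos : HasPositiveEigenvalues 𝒟.θ)
    (m : ℕ) (Y : 𝒟.Alg) (hY : 𝒟.toEnd Y ∈ 𝒟.filt m) (z : ℂ) :
    -- the sums over tuples of weights have only finitely many nonzero terms
    (∀ k : ℕ, {μ : Fin (k + 1) → 𝒟.weights |
      𝒟.nablaMulti hdiag k (fun i => (μ i : ℝ)) Y ≠ 0}.Finite) ∧
    -- the expansion with remainder
    (∀ n : ℕ, ∃ Q ∈ Δ.Op r (r * z.re + m - n - 1),
      Δ.cpow z * 𝒟.toEnd Y =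
        ∑ k ∈ Finset.range (n + 1), 𝒟.expansionTerm hdiag z Y k + Q) ∧
    -- the leading term
    𝒟.expansionTerm hdiag z Y 0 =
      𝒟.toEnd (diagCPow 𝒟.θ hdiag (r * z) Y) * Δ.cpow z ∧
    -- the asymptotic expansion
    Δ.HasAsymptoticExpansion r (Δ.cpow z * 𝒟.toEnd Y)
      (𝒟.expansionTerm hdiag z Y) := by
  have hr0 : r ≠ 0 := by omega
  have hterm := TwistedDOAlgebra.expansionTerm_eq hdiag hpos z Y
  have hrem : ∀ n : ℕ, Δ.cpow z * 𝒟.toEnd Y -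
      ∑ k ∈ Finset.range n, 𝒟.expansionTerm hdiag z Y k =
        TwistedDOAlgebra.remainder hdiag z n Y := fun n => by
    simp only [hterm]
    rfl
  have hOp := fun n => TwistedDOAlgebra.remainder_mem_Op hdiag hpos hr0 z n hY
  refine ⟨fun k => TwistedDOAlgebra.finite_nablaMulti_ne_zero hdiag k Y, fun n => ?_, ?_,
    ⟨_, by simpa [TwistedDOAlgebra.remainder] using hOp 0⟩, fun k => ?_, fun l => ?_⟩
  · refine ⟨TwistedDOAlgebra.remainder hdiag z (n + 1) Y, ?_, ?_⟩
    · have := hOp (n + 1)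
      rwa [Nat.cast_succ, ← sub_sub] at this
    · rw [← hrem, add_sub_cancel]
  · rw [hterm, TwistedDOAlgebra.coeffMap_zero_cpow hdiag hpos, Nat.cast_zero, sub_zero]
  · refine ⟨r * z.re + m - k, ?_⟩
    -- The order of a term is read off from the two remainders of which it is the difference.
    have e : 𝒟.expansionTerm hdiag z Y k = TwistedDOAlgebra.remainder hdiag z k Y -
        TwistedDOAlgebra.remainder hdiag z (k + 1) Y := by
      rw [hterm, TwistedDOAlgebra.remainder_succ, add_sub_cancel_left]
    rw [e]
    refine AbstractLaplace.sub_mem_Op (hOp k) (AbstractLaplace.Op_mono ?_ (hOp (k + 1)))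
    push_cast
    linarith
  -- The difference at stage `n` has order `r Re z + m - n - 1`, which is below `l` for `n` at least
  -- this value.
  · refine ⟨⌈r * z.re + m - l⌉₊, fun n hn => ?_⟩
    rw [hrem]
    refine AbstractLaplace.Op_mono ?_ (hOp (n + 1))
    have h1 : r * z.re + m - l ≤ n := (Nat.le_ceil _).trans (by exact_mod_cast hn)
    push_cast
    linarith
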